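/- Theorem (Cohen–Wu embedding). For $m\ge 1$ let $P_m$ be Artin's pure braid group on $m$ strands, that is, the kernel of the homomorphism from the braid group $B_m=\langle\sigma_1,\dots,\sigma_{m-1}\mid \sigma_i\sigma_j=\sigma_j\sigma_i\ (|i-j|>1),\ \sigma_i\sigma_{i+1}\sigma_i=\sigma_{i+1}\sigma_i\sigma_{i+1}\rangle$ to the symmetric group, and let $A_{1,2}=\sigma_1^2\in P_2$. Let $\mathrm{AP}$ be the simplicial group with $\mathrm{AP}_n=P_{n+1}$, $n\ge 0$, whose face map $d_i$ deletes the $(i+1)$-st strand and whose degeneracy map $s_i$ replaces the $(i+1)$-st strand by two parallel strands. Let $S^1=\Delta[1]/\partial\Delta[1]$ be the simplicial circle with its vertex as base point and its nondegenerate $1$-simplex $z$, and let $F[S^1]$ be Milnor's construction: $F[S^1]_n$ is the group generated by the $n$-simplices of $S^1$ with the only relation that the degeneracy of the base point is $1$. Then: (a) for every $n\ge 0$, $F[S^1]_n$ is the free group $F(z_1,\dots,z_n)$ on the simplices $z_i=s_0^{\,i-1}s_1^{\,n-i}z$, $1\le i\le n$; (b) there is a unique homomorphism of simplicial groups $\Theta\colon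 F[S^1]\to\mathrm{AP}$ with $\Theta(z)=A_{1,2}$; (c) $\Theta$ is injective in every degree, that is, $\Theta_n\colon F(z_1,\dots,z_n)\to P_{n+1}$ is injective for every $n\ge 0$. -/

import Mathlib

set_option linter.unusedSimpArgs false
set_option linter.unusedTactic false
set_option linter.unreachableTactic false
set_option linter.style.longLine false

open CategoryTheory Simplicial Opposite

/-! ### Simplicial objects from faces and degeneracies

The functor from the category presented by the cosimplicial generators and relations to the simplex
category is fully faithful, so objects with face and degeneracy maps that satisfy the simplicial
identities are the same as simplicial objects. -/

namespace SimplexCategoryGenRel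

theorem P_σ_ext {x y : SimplexCategoryGenRel} {f g : x ⟶ y} (hf : P_σ f) (hg : P_σ g)
    (h : toSimplexCategory.map f = toSimplexCategory.map g) : f = g := by
  obtain ⟨L, m, b, h1, h2, h3, hL, e⟩ := exists_normal_form_P_σ f hf
  obtain ⟨L', m', b', h1', h2', h3', hL', e'⟩ := exists_normal_form_P_σ g hg
  subst h1 h2
  obtain rfl : m' = m := congrArg len h1'
  obtain rfl : b = b' := by
    have := congrArg len h2'
    simpa using this
  have key : ∀ j, j < m' + b + 1 → simplicialEvalσ L j = simplicialEvalσ L' j := by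
    intro j hj
    have h4 := simplicialEvalσ_of_isAdmissible L (m' + b) m' hL (by omega) j hj
    have h5 := simplicialEvalσ_of_isAdmissible L' (m' + b) m' hL' (by omega) j hj
    rw [e, e'] at h
    exact h4.symm.trans ((congrArg (fun t : ⦋m' + b⦌ ⟶ ⦋m'⦌ =>
      (t.toOrderHom ⟨j, hj⟩ : ℕ)) h).trans h5)
  have : L = L' := by
    refine List.SortedLT.eq_of_mem_iff hL.sortedLT hL'.sortedLT fun j => ?_
    rw [mem_isAdmissible_iff L hL, mem_isAdmissible_iff L' hL', h3, h3']
    refine and_congr_right fun hj => ?_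
    rw [key j (by omega), key (j + 1) (by omega)]
  subst this
  rw [e, e']

theorem P_δ_cases {x : SimplexCategoryGenRel} {n : ℕ} {f : x ⟶ mk (n + 1)} (hf : P_δ f) :
    (∃ h : x = mk (n + 1), f = eqToHom h) ∨
      ∃ (i : Fin (n + 2)) (f' : x ⟶ mk n), P_δ f' ∧ f = f' ≫ δ i := by
  cases hf with
  | of _ h =>
    cases h with
    | δ i => exact Or.inr ⟨i, 𝟙 _, P_δ.id_mem _, by simp⟩
  | id => exact Or.inl ⟨rfl, rfl⟩
  | comp_of f' g hf' hg =>
    cases hg with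
    | δ i => exact Or.inr ⟨i, f', hf', rfl⟩

/-- The map of vertices underlying a morphism. -/
def vertexMap {x : SimplexCategoryGenRel} {n : ℕ} (f : x ⟶ mk n) (j : Fin (x.len + 1)) :
    Fin (n + 1) := (toSimplexCategory.map f).toOrderHom j

theorem vertexMap_comp_δ {x : SimplexCategoryGenRel} {n : ℕ} (f : x ⟶ mk n) (i : Fin (n + 2))
    (j : Fin (x.len + 1)) : vertexMap (f ≫ δ i) j = i.succAbove (vertexMap f j) := by
  unfold vertexMap
  rw [Functor.map_comp]
  rfl

theorem vertexMap_id {n : ℕ} (j : Fin (n + 1)) : vertexMap (𝟙 (mk n)) j = j := rfl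

theorem exists_fac_of_omit {x : SimplexCategoryGenRel} {n : ℕ} (f : x ⟶ mk (n + 1)) (hf : P_δ f)
    (i : Fin (n + 2)) (hi : ∀ j, vertexMap f j ≠ i) :
    ∃ f' : x ⟶ mk n, P_δ f' ∧ f = f' ≫ δ i := by
  induction n with
  | zero =>
    obtain ⟨rfl, rfl⟩ | ⟨k, f', hf', rfl⟩ := P_δ_cases hf
    · exact absurd (vertexMap_id i) (hi i)
    · by_cases h : k = i
      · subst h; exact ⟨f', hf', rfl⟩
      · obtain ⟨i', rfl⟩ := Fin.exists_succAbove_eq (Ne.symm h)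
        refine absurd ?_ (hi 0)
        rw [vertexMap_comp_δ]
        congr 1
        exact Subsingleton.elim (α := Fin 1) _ _
  | succ n ih =>
    obtain ⟨rfl, rfl⟩ | ⟨k, f', hf', rfl⟩ := P_δ_cases hf
    · exact absurd (vertexMap_id i) (hi i)
    · by_cases h : k = i
      · subst h; exact ⟨f', hf', rfl⟩
      · obtain ⟨i', rfl⟩ := Fin.exists_succAbove_eq (Ne.symm h)
        obtain ⟨g, hg, rfl⟩ := ih f' hf' i' fun j hj => hi j (by rw [vertexMap_comp_δ, hj])
        rcases lt_or_ge i'.castSucc k with hk | hk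
        · obtain ⟨k, rfl⟩ := Fin.eq_succ_of_ne_zero (Fin.ne_zero_of_lt hk)
          refine ⟨g ≫ δ k, P_δ.comp_mem _ _ hg (P_δ.δ k), ?_⟩
          rw [Fin.succAbove_of_castSucc_lt _ _ hk, Category.assoc, Category.assoc,
            δ_comp_δ (Fin.castSucc_lt_succ_iff.1 hk)]
        · obtain ⟨k, rfl⟩ := Fin.eq_castSucc_of_ne_last (x := k) (by
            rintro rfl
            exact absurd hk (not_le.2 (Fin.castSucc_lt_last i')))
          refine ⟨g ≫ δ k, P_δ.comp_mem _ _ hg (P_δ.δ k), ?_⟩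
          rw [Fin.succAbove_of_le_castSucc _ _ hk, Category.assoc, Category.assoc,
            δ_comp_δ (Fin.castSucc_le_castSucc_iff.1 hk)]

theorem P_δ_ext {x y : SimplexCategoryGenRel} {f g : x ⟶ y} (hf : P_δ f) (hg : P_δ g)
    (h : toSimplexCategory.map f = toSimplexCategory.map g) : f = g := by
  induction y using SimplexCategoryGenRel.rec with | _ n
  induction n with
  | zero =>
    obtain ⟨e, rfl⟩ | h1 := eq_or_len_le_of_P_δ hf
    · obtain ⟨e, rfl⟩ | h1 := eq_or_len_le_of_P_δ hg
      · rfl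
      · subst e; simp at h1
    · simp at h1
  | succ n ih =>
    obtain ⟨e, rfl⟩ | ⟨i, f', hf', rfl⟩ := P_δ_cases hf
    · obtain ⟨e, rfl⟩ | h1 := eq_or_len_le_of_P_δ hg
      · rfl
      · subst e; simp at h1
    · obtain ⟨g', hg', rfl⟩ := exists_fac_of_omit g hg i (by
        intro j
        have : vertexMap (f' ≫ δ i) j = vertexMap g j := congrArg (fun t => t.toOrderHom j) h
        rw [← this, vertexMap_comp_δ]
        exact Fin.succAbove_ne _ _)
      congr 1
      refine ih hf' hg' ?_
      ext j
      have : vertexMap (f' ≫ δ i) j = vertexMap (g' ≫ δ i) j :=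
        congrArg (fun t => t.toOrderHom j) h
      replace this := (vertexMap_comp_δ f' i j).symm.trans (this.trans (vertexMap_comp_δ g' i j))
      exact congrArg Fin.val (Fin.succAbove_right_injective this)

instance : toSimplexCategory.Faithful where
  map_injective {x y f g} h := by
    obtain ⟨z, e, m, he, hm, rfl⟩ := exists_P_σ_P_δ_factorization f
    obtain ⟨z', e', m', he', hm', rfl⟩ := exists_P_σ_P_δ_factorization g
    have h1 := isSplitEpi_toSimplexCategory_map_of_P_σ he
    have h1' := isSplitEpi_toSimplexCategory_map_of_P_σ he'
    have h2 := isSplitMono_toSimplexCategory_map_of_P_δ hm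
    have h2' := isSplitMono_toSimplexCategory_map_of_P_δ hm'
    have s1 := SimplexCategory.epi_iff_surjective.1 (inferInstance : Epi (toSimplexCategory.map e))
    have s1' := SimplexCategory.epi_iff_surjective.1 (inferInstance : Epi (toSimplexCategory.map e'))
    have s2 := SimplexCategory.mono_iff_injective.1 (inferInstance : Mono (toSimplexCategory.map m))
    have s2' := SimplexCategory.mono_iff_injective.1 (inferInstance : Mono (toSimplexCategory.map m'))
    rw [Functor.map_comp, Functor.map_comp] at h
    have hr : Set.range (toSimplexCategory.map m).toOrderHom =
        Set.range (toSimplexCategory.map m').toOrderHom := by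
      rw [← s1.range_comp (toSimplexCategory.map m).toOrderHom,
        ← s1'.range_comp (toSimplexCategory.map m').toOrderHom]
      have := congrArg (fun t => Set.range t.toOrderHom) h
      exact this
    have hc := congrArg Set.ncard hr
    rw [← Set.image_univ, ← Set.image_univ, Set.ncard_image_of_injective _ s2,
      Set.ncard_image_of_injective _ s2'] at hc
    simp only [Set.ncard_univ, Nat.card_eq_fintype_card, Fintype.card_fin] at hc
    obtain rfl : z = z' := by
      ext
      simpa using hc
    have hm2 : toSimplexCategory.map m = toSimplexCategory.map m' := by
      ext1
      ext1
      exact (StrictMono.range_inj ((toSimplexCategory.map m).toOrderHom.monotone.strictMono_of_injective s2)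
        ((toSimplexCategory.map m').toOrderHom.monotone.strictMono_of_injective s2')).1 hr
    rw [hm2, cancel_mono] at h
    rw [P_σ_ext he he' h, P_δ_ext hm hm' hm2]

theorem exists_lift {a b : SimplexCategory} (f : a ⟶ b) :
    ∃ g : mk a.len ⟶ mk b.len, toSimplexCategory.map g = f := by
  let W : MorphismProperty SimplexCategory := fun a b f =>
    ∃ g : mk a.len ⟶ mk b.len, toSimplexCategory.map g = f
  have : W.IsMultiplicative := {
    id_mem := fun a => ⟨𝟙 _, toSimplexCategory.map_id _⟩
    comp_mem := by
      rintro a b c _ _ ⟨g, rfl⟩ ⟨g', rfl⟩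
      exact ⟨g ≫ g', toSimplexCategory.map_comp _ _⟩ }
  have h := SimplexCategory.morphismProperty_eq_top W (fun i => ⟨δ i, rfl⟩) (fun i => ⟨σ i, rfl⟩)
  have : W f := by rw [h]; trivial
  exact this

/-- The inverse of `toSimplexCategory`. -/
noncomputable def ofSimplexCategory : SimplexCategory ⥤ SimplexCategoryGenRel where
  obj a := mk a.len
  map f := (exists_lift f).choose
  map_id a := toSimplexCategory.map_injective (by
    rw [(exists_lift (𝟙 a)).choose_spec]; exact (toSimplexCategory.map_id (mk a.len)).symm)
  map_comp {a b c} f g := toSimplexCategory.map_injective (by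
    rw [(exists_lift (f ≫ g)).choose_spec, Functor.map_comp, (exists_lift f).choose_spec,
      (exists_lift g).choose_spec]; rfl)

theorem ofSimplexCategory_map_δ {n : ℕ} (i : Fin (n + 2)) :
    ofSimplexCategory.map (SimplexCategory.δ i) = δ i :=
  toSimplexCategory.map_injective (exists_lift (SimplexCategory.δ i)).choose_spec

theorem ofSimplexCategory_map_σ {n : ℕ} (i : Fin (n + 1)) :
    ofSimplexCategory.map (SimplexCategory.σ i) = σ i :=
  toSimplexCategory.map_injective (exists_lift (SimplexCategory.σ i)).choose_spec

end SimplexCategoryGenRel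


universe v u

/-- The classical description of a simplicial object: a sequence of objects with face maps `d` and
degeneracy maps `s` that satisfy the simplicial identities (`f ≫ g` is `f` followed by `g`). -/
structure FacesDegeneracies (C : Type u) [Category.{v} C] where
  X : ℕ → C
  d : ∀ n : ℕ, Fin (n + 2) → (X (n + 1) ⟶ X n)
  s : ∀ n : ℕ, Fin (n + 1) → (X n ⟶ X (n + 1))
  dd : ∀ (n : ℕ) (i j : Fin (n + 2)), i ≤ j →
    d (n + 1) j.succ ≫ d n i = d (n + 1) i.castSucc ≫ d n j
  sd_le : ∀ (n : ℕ) (i : Fin (n + 2)) (j : Fin (n + 1)), i ≤ j.castSucc →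
    s (n + 1) j.succ ≫ d (n + 1) i.castSucc = d n i ≫ s n j
  sd_self : ∀ (n : ℕ) (i : Fin (n + 1)), s n i ≫ d n i.castSucc = 𝟙 (X n)
  sd_succ : ∀ (n : ℕ) (i : Fin (n + 1)), s n i ≫ d n i.succ = 𝟙 (X n)
  sd_gt : ∀ (n : ℕ) (i : Fin (n + 2)) (j : Fin (n + 1)), j.castSucc < i →
    s (n + 1) j.castSucc ≫ d (n + 1) i.succ = d n i ≫ s n j
  ss : ∀ (n : ℕ) (i j : Fin (n + 1)), i ≤ j →
    s n j ≫ s (n + 1) i.castSucc = s n i ≫ s (n + 1) j.succ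

namespace FacesDegeneracies
variable {C : Type u} [Category.{v} C]

theorem op_aux {a b b' c : C} {f : a ⟶ b} {g : b ⟶ c} {f' : a ⟶ b'} {g' : b' ⟶ c}
    (h : f ≫ g = f' ≫ g') : (𝟙 (op c) ≫ g.op) ≫ f.op = (𝟙 (op c) ≫ g'.op) ≫ f'.op := by
  simp only [Category.id_comp, ← op_comp, h]

theorem op_aux_id {a b : C} {f : a ⟶ b} {g : b ⟶ a} (h : f ≫ g = 𝟙 a) :
    (𝟙 (op a) ≫ g.op) ≫ f.op = 𝟙 (op a) := by
  simp only [Category.id_comp, ← op_comp, h, op_id]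

/-- The functor on the presented category. -/
def genRelFunctor (D : FacesDegeneracies C) : SimplexCategoryGenRel ⥤ Cᵒᵖ :=
  CategoryTheory.Quotient.lift FreeSimplexQuiver.homRel
    (Paths.lift (V := FreeSimplexQuiver)
      { obj := fun n => op (D.X n)
        map := fun f => match f with
          | FreeSimplexQuiver.Hom.δ i => (D.d _ i).op
          | FreeSimplexQuiver.Hom.σ i => (D.s _ i).op })
    (fun _ _ _ _ h => by
      cases h with
      | δ_comp_δ H => exact op_aux (D.dd _ _ _ H)
      | δ_comp_σ_of_le H => exact op_aux (D.sd_le _ _ _ H)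
      | δ_comp_σ_self => exact op_aux_id (D.sd_self _ _)
      | δ_comp_σ_succ => exact op_aux_id (D.sd_succ _ _)
      | δ_comp_σ_of_gt H => exact op_aux (D.sd_gt _ _ _ H)
      | σ_comp_σ H => exact op_aux (D.ss _ _ _ H))

/-- The simplicial object with the given faces and degeneracies. -/
noncomputable def toSimplicialObject (D : FacesDegeneracies C) : SimplicialObject C :=
  SimplexCategoryGenRel.ofSimplexCategory.op ⋙ D.genRelFunctor.leftOp

theorem toSimplicialObject_obj (D : FacesDegeneracies C) (n : ℕ) :
    D.toSimplicialObject _⦋n⦌ = D.X n := rfl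

theorem toSimplicialObject_δ (D : FacesDegeneracies C) {n : ℕ} (i : Fin (n + 2)) :
    D.toSimplicialObject.δ i = D.d n i :=
  (congrArg (fun t => (D.genRelFunctor.map t).unop)
    (SimplexCategoryGenRel.ofSimplexCategory_map_δ i)).trans
    (congrArg Quiver.Hom.unop (Category.id_comp (D.d n i).op))

theorem toSimplicialObject_σ (D : FacesDegeneracies C) {n : ℕ} (i : Fin (n + 1)) :
    D.toSimplicialObject.σ i = D.s n i :=
  (congrArg (fun t => (D.genRelFunctor.map t).unop)
    (SimplexCategoryGenRel.ofSimplexCategory_map_σ i)).trans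
    (congrArg Quiver.Hom.unop (Category.id_comp (D.s n i).op))

end FacesDegeneracies

/-! ### Braid groups -/

/-- The Artin relations between `σ_0, …, σ_{n-1}`: `σ_i σ_j = σ_j σ_i` for `|i - j| > 1` and
`σ_i σ_{i+1} σ_i = σ_{i+1} σ_i σ_{i+1}`. -/
def braidRels (n : ℕ) : Set (FreeGroup (Fin n)) :=
  {r | ∃ i j : Fin n, (i : ℕ) + 1 < j ∧
    r = FreeGroup.of i * FreeGroup.of j * (FreeGroup.of j * FreeGroup.of i)⁻¹} ∪
  {r | ∃ i j : Fin n, (i : ℕ) + 1 = j ∧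
    r = FreeGroup.of i * FreeGroup.of j * FreeGroup.of i *
      (FreeGroup.of j * FreeGroup.of i * FreeGroup.of j)⁻¹}

/-- The Artin braid group on `n + 1` strands, which are numbered `0, …, n`. The product `a * b` is
`a` followed by `b`. -/
abbrev BraidGroup (n : ℕ) : Type := PresentedGroup (braidRels n)

namespace BraidGroup

/-- The generator `σ_i`, in which the strands at the positions `i` and `i + 1` cross
(for `i ≥ n` the value is `1`, a junk value). -/
def gen (n i : ℕ) : BraidGroup n :=
  if h : i < n then PresentedGroup.of ⟨i, h⟩ else 1

theorem gen_comm {n i j : ℕ} (h : i + 1 < j) : gen n i * gen n j = gen n j * gen n i := by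
  unfold gen
  split_ifs with h1 h2
  · exact PresentedGroup.mk_eq_mk_of_mul_inv_mem (rels := braidRels n)
      (Or.inl ⟨⟨i, h1⟩, ⟨j, h2⟩, h, rfl⟩)
  · simp
  · simp
  · simp

theorem gen_braid {n i : ℕ} (h : i + 1 < n) :
    gen n i * gen n (i + 1) * gen n i = gen n (i + 1) * gen n i * gen n (i + 1) := by
  unfold gen
  rw [dif_pos h, dif_pos (by omega)]
  exact PresentedGroup.mk_eq_mk_of_mul_inv_mem (rels := braidRels n)
      (Or.inr ⟨⟨i, by omega⟩, ⟨i + 1, h⟩, rfl, rfl⟩)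

/-- The universal property of the presentation. -/
def lift {n : ℕ} {G : Type*} [Group G] (f : Fin n → G)
    (hc : ∀ i j : Fin n, (i : ℕ) + 1 < j → f i * f j = f j * f i)
    (hb : ∀ i j : Fin n, (i : ℕ) + 1 = j → f i * f j * f i = f j * f i * f j) :
    BraidGroup n →* G :=
  PresentedGroup.toGroup (rels := braidRels n) (f := f) (by
    rintro r (⟨i, j, h, rfl⟩ | ⟨i, j, h, rfl⟩)
    · rw [map_mul, map_inv, mul_inv_eq_one]; simpa using hc i j h
    · rw [map_mul, map_inv, mul_inv_eq_one]; simpa using hb i j h)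

/-- The transposition of the positions `i` and `i + 1`. -/
def transp {n : ℕ} (i : Fin n) : Equiv.Perm (Fin (n + 1)) := Equiv.swap i.castSucc i.succ

/-- The position in which a strand that starts at position `k` ends, under `σ_i`. -/
def pos (i k : ℕ) : ℕ := if k = i then i + 1 else if k = i + 1 then i else k

theorem transp_val {n : ℕ} (i : Fin n) (k : Fin (n + 1)) :
    (transp i k : ℕ) = pos i k := by
  simp only [transp, Equiv.swap_apply_def, pos, Fin.ext_iff, Fin.val_castSucc, Fin.val_succ]
  split_ifs <;> simp

theorem transp_inv {n : ℕ} (i : Fin n) : (transp i)⁻¹ = transp i := by simp [transp]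

theorem transp_comm {n : ℕ} (i j : Fin n) (h : (i : ℕ) + 1 < j) :
    transp i * transp j = transp j * transp i := by
  ext k; simp only [Equiv.Perm.mul_apply, transp_val, pos]; grind

theorem transp_braid {n : ℕ} (i j : Fin n) (h : (i : ℕ) + 1 = j) :
    transp i * transp j * transp i = transp j * transp i * transp j := by
  ext k; simp only [Equiv.Perm.mul_apply, transp_val, pos]; grind

/-- The underlying permutation of a braid. -/
def perm (n : ℕ) : BraidGroup n →* Equiv.Perm (Fin (n + 1)) :=
  lift transp transp_comm transp_braid

section Crossed
variable {n : ℕ} {H : Type*} [Group H]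

/-- Crossed homomorphisms `F : BraidGroup n → Fin (n + 1) → H`, that is, maps with
`F (a * b) k = F a k * F b k'` if the strand `k` of `a` ends at `k'`, are the same as homomorphisms
to the semidirect product below which lift the underlying permutation. Here such a
homomorphism is built from the values `f i k` of `F σ_i k`. -/
def crossedHom (f : ℕ → ℕ → H)
    (hc : ∀ i j k : ℕ, i + 1 < j → j < n → k < n + 1 →
      f i k * f j (pos i k) = f j k * f i (pos j k))
    (hb : ∀ i k : ℕ, i + 1 < n → k < n + 1 →
      f i k * f (i + 1) (pos i k) * f i (pos (i + 1) (pos i k)) =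
      f (i + 1) k * f i (pos (i + 1) k) * f (i + 1) (pos i (pos (i + 1) k))) :
    BraidGroup n →* (Fin (n + 1) → H) ⋊[mulAutArrow] Equiv.Perm (Fin (n + 1)) :=
  lift (fun i => ⟨fun k => f i k, transp i⟩)
    (fun i j h => by
      ext1
      · funext k
        have := hc i j k h j.2 k.2
        rw [← transp_val i k, ← transp_val j k] at this
        exact this
      · exact transp_comm i j h)
    (fun i j h => by
      ext1
      · funext k
        have := hb i k (by omega) k.2
        simp only [h, ← transp_val] at this
        exact this
      · exact transp_braid i j h)
end Crossed

/-- The braid `σ_i` with the strand that starts at position `k` replaced by two parallel strands. -/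
def dupGen (n i k : ℕ) : BraidGroup (n + 1) :=
  if k < i then gen (n + 1) (i + 1)
  else if k = i then gen (n + 1) (i + 1) * gen (n + 1) i
  else if k = i + 1 then gen (n + 1) i * gen (n + 1) (i + 1)
  else gen (n + 1) i

/-- The braid `σ_i` on `n + 2` strands with the strand that starts at position `k` deleted. -/
def delGen (n i k : ℕ) : BraidGroup n :=
  if k < i then gen n (i - 1)
  else if k = i ∨ k = i + 1 then 1
  else gen n i


theorem word_a {G : Type*} [Monoid G] {a b c : G} (h1 : a * c = c * a) (h2 : b * c = c * b) :
    a * b * c = c * (a * b) := by rw [mul_assoc, h2, ← mul_assoc, h1, mul_assoc]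


section Rules
variable {n i k : ℕ}
theorem pos_lt (h : k < i) : pos i k = k := by unfold pos; grind
theorem pos_self (h : k = i) : pos i k = i + 1 := by unfold pos; grind
theorem pos_succ (h : k = i + 1) : pos i k = i := by unfold pos; grind
theorem pos_gt (h : i + 1 < k) : pos i k = k := by unfold pos; grind
theorem dupGen_lt (h : k < i) : dupGen n i k = gen (n + 1) (i + 1) := if_pos h
theorem dupGen_self (h : k = i) : dupGen n i k = gen (n + 1) (i + 1) * gen (n + 1) i := by
  subst h; simp [dupGen]
theorem dupGen_succ (h : k = i + 1) : dupGen n i k = gen (n + 1) i * gen (n + 1) (i + 1) := by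
  subst h; simp [dupGen]
theorem dupGen_gt (h : i + 1 < k) : dupGen n i k = gen (n + 1) i := by
  unfold dupGen; grind
theorem delGen_lt (h : k < i) : delGen n i k = gen n (i - 1) := if_pos h
theorem delGen_self (h : k = i) : delGen n i k = 1 := by subst h; simp [delGen]
theorem delGen_succ (h : k = i + 1) : delGen n i k = 1 := by subst h; simp [delGen]
theorem delGen_gt (h : i + 1 < k) : delGen n i k = gen n i := by unfold delGen; grind
end Rules

theorem dup_c (n i j k : ℕ) (h : i + 1 < j) : 
    dupGen n i k * dupGen n j (pos i k) = dupGen n j k * dupGen n i (pos j k) := by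
  have c1 := gen_comm (n := n+1) (i := i) (j := j) (by omega)
  have c2 := gen_comm (n := n+1) (i := i) (j := j+1) (by omega)
  have c3 := gen_comm (n := n+1) (i := i+1) (j := j+1) (by omega)
  rcases (by omega : k < i ∨ k = i ∨ k = i + 1 ∨ (i + 1 < k ∧ k < j) ∨ k = j ∨ k = j + 1 ∨ j + 1 < k)
    with h | h | h | h | h | h | h <;>
  simp (disch := omega) only [pos_lt, pos_self, pos_succ, pos_gt, dupGen_lt, dupGen_self,
    dupGen_succ, dupGen_gt]
  · exact c3
  · exact word_a c3 c2
  · exact word_a c2 c3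
  · exact c2
  · exact (word_a c2.symm c1.symm).symm
  · exact (word_a c1.symm c2.symm).symm
  · exact c1

theorem del_c (n i j k : ℕ) (h : i + 1 < j) : 
    delGen n i k * delGen n j (pos i k) = delGen n j k * delGen n i (pos j k) := by
  rcases (by omega : k < i ∨ k = i ∨ k = i + 1 ∨ (i + 1 < k ∧ k < j) ∨ k = j ∨ k = j + 1 ∨ j + 1 < k)
    with h | h | h | h | h | h | h <;>
  simp (disch := omega) only [pos_lt, pos_self, pos_succ, pos_gt, delGen_lt, delGen_self,
    delGen_succ, delGen_gt, one_mul, mul_one] <;> exact gen_comm (by omega)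

theorem dup_b (n i k : ℕ) (h : i + 1 < n) :
    dupGen n i k * dupGen n (i + 1) (pos i k) * dupGen n i (pos (i + 1) (pos i k)) =
      dupGen n (i + 1) k * dupGen n i (pos (i + 1) k) * dupGen n (i + 1) (pos i (pos (i + 1) k)) := by
  have c := gen_comm (n := n+1) (i := i) (j := i + 2) (by omega)
  have b1 := gen_braid (n := n+1) (i := i) (by omega)
  have b2 := gen_braid (n := n+1) (i := i+1) (by omega)
  rcases (by omega : k < i ∨ k = i ∨ k = i + 1 ∨ k = i + 2 ∨ i + 2 < k) with h | h | h | h | h <;>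
  simp (disch := omega) only [pos_lt, pos_self, pos_succ, pos_gt, dupGen_lt, dupGen_self,
    dupGen_succ, dupGen_gt] <;> 
  generalize gen (n+1) i = a at * <;>
  generalize gen (n+1) (i+2) = d at * <;>
  generalize gen (n+1) (i+1) = b at * 
  · exact b2
  · calc b * a * (d * b) * a = b * (a * d) * b * a := by simp only [mul_assoc]
      _ = b * d * (a * b * a) := by rw [c]; simp only [mul_assoc]
      _ = b * d * b * (a * b) := by rw [b1]; simp only [mul_assoc]
      _ = d * b * (d * a) * b := by rw [b2]; simp only [mul_assoc]
      _ = d * (b * a) * (d * b) := by rw [← c]; simp only [mul_assoc]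
  · calc a * b * d * (b * a) = a * (b * d * b) * a := by simp only [mul_assoc]
      _ = a * d * b * (d * a) := by rw [b2]; simp only [mul_assoc]
      _ = d * a * b * (d * a) := by rw [c]
      _ = d * a * b * (a * d) := by rw [c]
      _ = d * (a * b * a) * d := by simp only [mul_assoc]
      _ = d * b * a * (b * d) := by rw [b1]; simp only [mul_assoc]
  · calc a * (b * d) * (a * b) = a * b * (d * a) * b := by simp only [mul_assoc]
      _ = a * b * a * d * b := by rw [← c]; simp only [mul_assoc]
      _ = b * a * (b * d * b) := by rw [b1]; simp only [mul_assoc]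
      _ = b * (a * d) * b * d := by rw [b2]; simp only [mul_assoc]
      _ = b * d * (a * b) * d := by rw [c]; simp only [mul_assoc]
  · exact b1

theorem del_b (n i k : ℕ) (h : i + 1 < n + 1) (hk : k < n + 2) :
    delGen n i k * delGen n (i + 1) (pos i k) * delGen n i (pos (i + 1) (pos i k)) =
      delGen n (i + 1) k * delGen n i (pos (i + 1) k) * delGen n (i + 1) (pos i (pos (i + 1) k)) := by
  rcases (by omega : k < i ∨ k = i ∨ k = i + 1 ∨ k = i + 2 ∨ i + 2 < k) with h | h | h | h | h <;>
  simp (disch := omega) only [pos_lt, pos_self, pos_succ, pos_gt, delGen_lt, delGen_self,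
    delGen_succ, delGen_gt, one_mul, mul_one, Nat.add_sub_cancel]
  · obtain ⟨i, rfl⟩ : ∃ j, i = j + 1 := ⟨i - 1, by omega⟩
    exact gen_braid (n := n) (i := i) (by omega)
  · exact gen_braid (n := n) (i := i) (by omega)


theorem induct {n : ℕ} {P : BraidGroup n → Prop} (hg : ∀ i : ℕ, i < n → P (gen n i)) (h1 : P 1)
    (hm : ∀ a b, P a → P b → P (a * b)) (hi : ∀ a, P a → P a⁻¹) (a : BraidGroup n) : P a :=
  PresentedGroup.generated_by (braidRels n)
    { carrier := {a | P a}, one_mem' := h1, mul_mem' := fun {a b} => hm a b,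
      inv_mem' := fun {a} => hi a }
    (fun j => by simpa [gen] using hg j j.2) a

theorem lift_gen {n : ℕ} {G : Type*} [Group G] (f : Fin n → G) (hc hb) {i : ℕ} (h : i < n) :
    lift f hc hb (gen n i) = f ⟨i, h⟩ := by
  rw [gen, dif_pos h]
  exact PresentedGroup.toGroup.of _

/-- The position in which the strand of `a` that starts at position `k` ends. -/
def ends {n : ℕ} (a : BraidGroup n) (k : Fin (n + 1)) : Fin (n + 1) := (perm n a)⁻¹ k

/-- Strand doubling on all braids, as a homomorphism to a semidirect product. -/
def dupCrossed (n : ℕ) :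
    BraidGroup n →* (Fin (n + 1) → BraidGroup (n + 1)) ⋊[mulAutArrow] Equiv.Perm (Fin (n + 1)) :=
  crossedHom (dupGen n) (fun i j k h _ _ => dup_c n i j k h) (fun i k h _ => dup_b n i k h)

/-- Strand deletion on all braids, as a homomorphism to a semidirect product. -/
def delCrossed (n : ℕ) :
    BraidGroup (n + 1) →* (Fin (n + 2) → BraidGroup n) ⋊[mulAutArrow] Equiv.Perm (Fin (n + 2)) :=
  crossedHom (delGen n) (fun i j k h _ _ => del_c n i j k h) (fun i k h hk => del_b n i k h hk)

/-- The braid `a` with the strand that starts at position `k` doubled. -/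
def dup {n : ℕ} (a : BraidGroup n) (k : Fin (n + 1)) : BraidGroup (n + 1) := (dupCrossed n a).left k

/-- The braid `a` with the strand that starts at position `k` deleted. -/
def del {n : ℕ} (a : BraidGroup (n + 1)) (k : Fin (n + 2)) : BraidGroup n := (delCrossed n a).left k

theorem crossedHom_right {n : ℕ} {H : Type*} [Group H] (f : ℕ → ℕ → H) (hc hb)
    (a : BraidGroup n) : (crossedHom f hc hb a).right = perm n a := by
  change (SemidirectProduct.rightHom.comp (crossedHom f hc hb)) a = perm n a
  congr 1
  refine PresentedGroup.ext fun i => ?_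
  change (crossedHom f hc hb (PresentedGroup.of i)).right = _
  unfold crossedHom perm lift
  rw [PresentedGroup.toGroup.of, PresentedGroup.toGroup.of]

section Basic
variable {n : ℕ}

theorem ends_gen {i : ℕ} (h : i < n) (k : Fin (n + 1)) : (ends (gen n i) k : ℕ) = pos i k := by
  unfold ends perm
  rw [lift_gen _ _ _ h, transp_inv, transp_val]
theorem ends_mul (a b : BraidGroup n) (k : Fin (n + 1)) :
    ends (a * b) k = ends b (ends a k) := by simp [ends]
theorem ends_one (k : Fin (n + 1)) : ends (1 : BraidGroup n) k = k := by simp [ends]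
theorem ends_ends_inv (a : BraidGroup n) (k : Fin (n + 1)) : ends a (ends a⁻¹ k) = k := by
  simp [ends]
theorem ends_inv_ends (a : BraidGroup n) (k : Fin (n + 1)) : ends a⁻¹ (ends a k) = k := by
  simp [ends]

theorem dup_mul (a b : BraidGroup n) (k : Fin (n + 1)) :
    dup (a * b) k = dup a k * dup b (ends a k) := by
  have : (dupCrossed n a).right = perm n a := crossedHom_right _ _ _ a
  unfold dup ends
  rw [map_mul, SemidirectProduct.mul_left, ← this]
  rfl
theorem dup_one (k : Fin (n + 1)) : dup (1 : BraidGroup n) k = 1 := by simp [dup]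
theorem dup_inv (a : BraidGroup n) (k : Fin (n + 1)) : dup a⁻¹ k = (dup a (ends a⁻¹ k))⁻¹ := by
  have := dup_mul a a⁻¹ (ends a⁻¹ k)
  rw [mul_inv_cancel, dup_one, ends_ends_inv] at this
  exact (inv_eq_of_mul_eq_one_right this.symm).symm
theorem dup_gen {i : ℕ} (h : i < n) (k : Fin (n + 1)) : dup (gen n i) k = dupGen n i k := by
  unfold dup dupCrossed crossedHom
  rw [lift_gen _ _ _ h]

theorem del_mul (a b : BraidGroup (n + 1)) (k : Fin (n + 2)) :
    del (a * b) k = del a k * del b (ends a k) := by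
  have : (delCrossed n a).right = perm _ a := crossedHom_right _ _ _ a
  unfold del ends
  rw [map_mul, SemidirectProduct.mul_left, ← this]
  rfl
theorem del_one (k : Fin (n + 2)) : del (1 : BraidGroup (n + 1)) k = 1 := by simp [del]
theorem del_inv (a : BraidGroup (n + 1)) (k : Fin (n + 2)) :
    del a⁻¹ k = (del a (ends a⁻¹ k))⁻¹ := by
  have := del_mul a a⁻¹ (ends a⁻¹ k)
  rw [mul_inv_cancel, del_one, ends_ends_inv] at this
  exact (inv_eq_of_mul_eq_one_right this.symm).symm
theorem del_gen {i : ℕ} (h : i < n + 1) (k : Fin (n + 2)) :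
    del (gen (n + 1) i) k = delGen n i k := by
  unfold del delCrossed crossedHom
  rw [lift_gen _ _ _ h]

theorem succAbove_val (p : Fin (n + 1)) (j : Fin n) :
    (p.succAbove j : ℕ) = if (j : ℕ) < p then (j : ℕ) else j + 1 := by
  simp only [Fin.succAbove, Fin.lt_def, Fin.val_castSucc]
  split_ifs <;> simp

theorem succAbove_lt {p : Fin (n + 1)} {j : Fin n} (h : (j : ℕ) < p) :
    (p.succAbove j : ℕ) = j := by rw [succAbove_val, if_pos h]
theorem succAbove_ge {p : Fin (n + 1)} {j : Fin n} (h : (p : ℕ) ≤ j) :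
    (p.succAbove j : ℕ) = j + 1 := by rw [succAbove_val, if_neg (by omega)]

theorem ends_dup_a (a : BraidGroup n) (i j : Fin (n + 1)) :
    ends (dup a i) (i.castSucc.succAbove j) = (ends a i).castSucc.succAbove (ends a j) := by
  induction a using induct generalizing i j with
  | hg b hb =>
    ext
    rw [dup_gen hb]
    rcases (by omega : (i : ℕ) < b ∨ (i : ℕ) = b ∨ (i : ℕ) = b + 1 ∨ b + 1 < (i : ℕ))
      with h | h | h | h <;>
    rcases (by omega : (j : ℕ) < b ∨ (j : ℕ) = b ∨ (j : ℕ) = b + 1 ∨ b + 1 < (j : ℕ))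
      with h' | h' | h' | h' <;>
    rcases (by omega : (j : ℕ) < i ∨ (i : ℕ) ≤ j)
      with h'' | h'' <;> first | omega | 
    simp (disch := first | omega |
        simp (disch := omega) only [ends_gen, pos_lt, pos_self, pos_succ, pos_gt,
          succAbove_lt, succAbove_ge, Fin.val_castSucc, Fin.val_succ]; omega) only
      [dupGen_lt, dupGen_self, dupGen_succ, dupGen_gt, delGen_lt, delGen_self, delGen_succ,
      delGen_gt, ends_mul, ends_one, ends_gen, succAbove_lt, succAbove_ge, Fin.val_castSucc, Fin.val_succ,
      pos_lt, pos_self, pos_succ, pos_gt]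
  | h1 => simp [dup_one, ends_one]
  | hm a b ha hb => rw [dup_mul, ends_mul, ha, hb, ends_mul, ends_mul]
  | hi a ha =>
    rw [dup_inv]
    have := ha (ends a⁻¹ i) (ends a⁻¹ j)
    rw [ends_ends_inv, ends_ends_inv] at this
    rw [← this, ends_inv_ends]

theorem ends_dup_b (a : BraidGroup n) (i j : Fin (n + 1)) :
    ends (dup a i) (i.succ.succAbove j) = (ends a i).succ.succAbove (ends a j) := by
  induction a using induct generalizing i j with
  | hg b hb =>
    ext
    rw [dup_gen hb]
    rcases (by omega : (i : ℕ) < b ∨ (i : ℕ) = b ∨ (i : ℕ) = b + 1 ∨ b + 1 < (i : ℕ))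
      with h | h | h | h <;>
    rcases (by omega : (j : ℕ) < b ∨ (j : ℕ) = b ∨ (j : ℕ) = b + 1 ∨ b + 1 < (j : ℕ))
      with h' | h' | h' | h' <;>
    rcases (by omega : (j : ℕ) ≤ i ∨ (i : ℕ) < j)
      with h'' | h'' <;> first | omega | 
    simp (disch := first | omega |
        simp (disch := omega) only [ends_gen, pos_lt, pos_self, pos_succ, pos_gt,
          succAbove_lt, succAbove_ge, Fin.val_castSucc, Fin.val_succ]; omega) only
      [dupGen_lt, dupGen_self, dupGen_succ, dupGen_gt, delGen_lt, delGen_self, delGen_succ,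
      delGen_gt, ends_mul, ends_one, ends_gen, succAbove_lt, succAbove_ge, Fin.val_castSucc, Fin.val_succ,
      pos_lt, pos_self, pos_succ, pos_gt]
  | h1 => simp [dup_one, ends_one]
  | hm a b ha hb => rw [dup_mul, ends_mul, ha, hb, ends_mul, ends_mul]
  | hi a ha =>
    rw [dup_inv]
    have := ha (ends a⁻¹ i) (ends a⁻¹ j)
    rw [ends_ends_inv, ends_ends_inv] at this
    rw [← this, ends_inv_ends]

theorem ends_del (a : BraidGroup (n + 1)) (i : Fin (n + 2)) (j : Fin (n + 1)) :
    (ends a i).succAbove (ends (del a i) j) = ends a (i.succAbove j) := by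
  induction a using induct generalizing i j with
  | hg b hb =>
    ext
    rw [del_gen hb, ends_gen hb]
    rcases (by omega : (i : ℕ) < b ∨ (i : ℕ) = b ∨ (i : ℕ) = b + 1 ∨ b + 1 < (i : ℕ))
      with h | h | h | h <;>
    rcases (by omega : (j : ℕ) + 1 < b ∨ (j : ℕ) + 1 = b ∨ (j : ℕ) = b ∨ (j : ℕ) = b + 1 ∨ b + 1 < (j : ℕ))
      with h' | h' | h' | h' | h' <;>
    rcases (by omega : (j : ℕ) < i ∨ (i : ℕ) ≤ j)
      with h'' | h'' <;> first | omega | 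
    simp (disch := first | omega |
        simp (disch := omega) only [ends_gen, pos_lt, pos_self, pos_succ, pos_gt,
          succAbove_lt, succAbove_ge, Fin.val_castSucc, Fin.val_succ]; omega) only
      [dupGen_lt, dupGen_self, dupGen_succ, dupGen_gt, delGen_lt, delGen_self, delGen_succ,
      delGen_gt, ends_mul, ends_one, ends_gen, succAbove_lt, succAbove_ge, Fin.val_castSucc, Fin.val_succ,
      pos_lt, pos_self, pos_succ, pos_gt]
    all_goals try omega
  | h1 => simp [del_one, ends_one]
  | hm a b ha hb => rw [del_mul, ends_mul, ends_mul, hb, ha, ends_mul]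
  | hi a ha =>
    rw [del_inv]
    have := ha (ends a⁻¹ i) (ends (del a (ends a⁻¹ i))⁻¹ j)
    rw [ends_ends_inv, ends_ends_inv] at this
    rw [this, ends_inv_ends]

theorem succAbove_cases {p : Fin (n + 1)} {j : Fin n} {q : Fin (n + 1)} (h : p.succAbove j = q) :
    ((j : ℕ) < p ∧ (q : ℕ) = j) ∨ ((p : ℕ) ≤ j ∧ (q : ℕ) = j + 1) := by
  subst h
  rw [succAbove_val]
  split_ifs with h <;> omega

theorem del_del (a : BraidGroup (n + 2)) (i j : Fin (n + 3)) (i' j' : Fin (n + 2))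
    (hj : i.succAbove j' = j) (hi : j.succAbove i' = i) :
    del (del a i) j' = del (del a j) i' := by
  induction a using induct generalizing i j i' j' with
  | hg b hb =>
    replace hj := succAbove_cases hj
    replace hi := succAbove_cases hi
    rw [del_gen hb, del_gen hb]
    rcases (by omega : (i : ℕ) < b ∨ (i : ℕ) = b ∨ (i : ℕ) = b + 1 ∨ b + 1 < (i : ℕ))
      with h | h | h | h <;>
    rcases (by omega : (j : ℕ) < b ∨ (j : ℕ) = b ∨ (j : ℕ) = b + 1 ∨ b + 1 < (j : ℕ))
      with h' | h' | h' | h' <;>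
    rcases (by omega : (i : ℕ) < j ∧ (i' : ℕ) = i ∧ (j' : ℕ) + 1 = j ∨
      (j : ℕ) < i ∧ (j' : ℕ) = j ∧ (i' : ℕ) + 1 = i) with h'' | h'' <;> first | omega |
    simp (disch := first | omega |
        simp (disch := omega) only [ends_gen, pos_lt, pos_self, pos_succ, pos_gt,
          succAbove_lt, succAbove_ge, Fin.val_castSucc, Fin.val_succ]; omega) only
      [dupGen_lt, dupGen_self, dupGen_succ, dupGen_gt, delGen_lt, delGen_self, delGen_succ,
      delGen_gt, dup_mul, dup_one, dup_gen, del_mul, del_one, del_gen, ends_gen, succAbove_lt,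
      succAbove_ge, Fin.val_castSucc, Fin.val_succ, pos_lt, pos_self, pos_succ, pos_gt,
      Nat.add_sub_cancel, Nat.sub_add_cancel, mul_one, one_mul, mul_assoc]
  | h1 => simp [del_one]
  | hm a b ha hb =>
    rw [del_mul, del_mul, ha i j i' j' hj hi, del_mul, del_mul,
      hb (ends a i) (ends a j) (ends (del a j) i') (ends (del a i) j')]
    · rw [ends_del, hj]
    · rw [ends_del, hi]
  | hi a ha =>
    rw [del_inv a i, del_inv a j, del_inv _ j', del_inv _ i', ← del_inv a i, ← del_inv a j,
      ha (ends a⁻¹ i) (ends a⁻¹ j) (ends (del a⁻¹ j) i') (ends (del a⁻¹ i) j')]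
    · rw [ends_del, hj]
    · rw [ends_del, hi]
theorem dup_dup (a : BraidGroup n) (i j : Fin (n + 1)) :
    dup (dup a i) (i.castSucc.succAbove j) = dup (dup a j) (j.succ.succAbove i) := by
  induction a using induct generalizing i j with
  | hg b hb =>
    have c := gen_comm (n := n + 2) (i := b) (j := b + 1 + 1) (by omega)
    have c' : ∀ x, gen (n + 2) b * (gen (n + 2) (b + 1 + 1) * x) = 
      gen (n + 2) (b + 1 + 1) * (gen (n + 2) b * x) := fun x => by
        rw [← mul_assoc, c, mul_assoc]
    rw [dup_gen hb, dup_gen hb]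
    rcases (by omega : (i : ℕ) < b ∨ (i : ℕ) = b ∨ (i : ℕ) = b + 1 ∨ b + 1 < (i : ℕ))
      with h | h | h | h <;>
    rcases (by omega : (j : ℕ) < b ∨ (j : ℕ) = b ∨ (j : ℕ) = b + 1 ∨ b + 1 < (j : ℕ))
      with h' | h' | h' | h' <;>
    rcases (by omega : (i : ℕ) ≤ j ∨ (j : ℕ) < i) with h'' | h'' <;> first | omega |
    simp (disch := first | omega |
        simp (disch := omega) only [ends_gen, pos_lt, pos_self, pos_succ, pos_gt,
          succAbove_lt, succAbove_ge, Fin.val_castSucc, Fin.val_succ]; omega) only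
      [dupGen_lt, dupGen_self, dupGen_succ, dupGen_gt, delGen_lt, delGen_self, delGen_succ,
      delGen_gt, dup_mul, dup_one, dup_gen, del_mul, del_one, del_gen, ends_gen, succAbove_lt,
      succAbove_ge, Fin.val_castSucc, Fin.val_succ, pos_lt, pos_self, pos_succ, pos_gt,
      Nat.add_sub_cancel, Nat.sub_add_cancel, mul_one, one_mul, mul_assoc]
    all_goals rw [c']
  | h1 => simp [dup_one]
  | hm a b ha hb =>
    rw [dup_mul, dup_mul, ha, dup_mul, dup_mul, ends_dup_a, hb, ends_dup_b]
  | hi a ha =>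
    rw [dup_inv a i, dup_inv a j, dup_inv, dup_inv, ← dup_inv a i, ← dup_inv a j,
      ends_dup_a, ends_dup_b, ha]
theorem del_dup (a : BraidGroup (n + 1)) (i j : Fin (n + 2)) (i' : Fin (n + 1))
    (hi : j.succAbove i' = i) :
    del (dup a i) (i.castSucc.succAbove j) = dup (del a j) i' := by
  induction a using induct generalizing i j i' with
  | hg b hb =>
    replace hi := succAbove_cases hi
    rw [del_gen hb, dup_gen hb]
    rcases (by omega : (i : ℕ) < b ∨ (i : ℕ) = b ∨ (i : ℕ) = b + 1 ∨ b + 1 < (i : ℕ))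
      with h | h | h | h <;>
    rcases (by omega : (j : ℕ) < b ∨ (j : ℕ) = b ∨ (j : ℕ) = b + 1 ∨ b + 1 < (j : ℕ))
      with h' | h' | h' | h' <;>
    rcases (by omega : (i : ℕ) < j ∧ (i' : ℕ) = i ∨
      (j : ℕ) < i ∧ (i' : ℕ) + 1 = i) with h'' | h'' <;> first | omega |
    simp (disch := first | omega |
        simp (disch := omega) only [ends_gen, pos_lt, pos_self, pos_succ, pos_gt,
          succAbove_lt, succAbove_ge, Fin.val_castSucc, Fin.val_succ]; omega) only
      [dupGen_lt, dupGen_self, dupGen_succ, dupGen_gt, delGen_lt, delGen_self, delGen_succ,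
      delGen_gt, dup_mul, dup_one, dup_gen, del_mul, del_one, del_gen, ends_gen, succAbove_lt,
      succAbove_ge, Fin.val_castSucc, Fin.val_succ, pos_lt, pos_self, pos_succ, pos_gt,
      Nat.add_sub_cancel, Nat.sub_add_cancel, mul_one, one_mul, mul_assoc]
  | h1 => simp [del_one, dup_one]
  | hm a b ha hb =>
    rw [dup_mul, del_mul, ha i j i' hi, del_mul, dup_mul, ends_dup_a, hb _ _ (ends (del a j) i')]
    rw [ends_del, hi]
  | hi a ha =>
    rw [dup_inv a i, del_inv a j, dup_inv, del_inv, ← dup_inv a i, ← del_inv a j,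
      ends_dup_a, ha _ _ (ends (del a⁻¹ j) i')]
    rw [ends_del, hi]
theorem del_dup_castSucc (a : BraidGroup n) (i : Fin (n + 1)) : del (dup a i) i.castSucc = a := by
  induction a using induct generalizing i with
  | hg b hb =>
    rw [dup_gen hb]
    rcases (by omega : (i : ℕ) < b ∨ (i : ℕ) = b ∨ (i : ℕ) = b + 1 ∨ b + 1 < (i : ℕ))
      with h | h | h | h <;>
    simp (disch := first | omega |
        simp (disch := omega) only [ends_gen, pos_lt, pos_self, pos_succ, pos_gt,
          succAbove_lt, succAbove_ge, Fin.val_castSucc, Fin.val_succ]; omega) only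
      [dupGen_lt, dupGen_self, dupGen_succ, dupGen_gt, delGen_lt, delGen_self, delGen_succ,
      delGen_gt, dup_mul, dup_one, dup_gen, del_mul, del_one, del_gen, ends_gen, succAbove_lt,
      succAbove_ge, Fin.val_castSucc, Fin.val_succ, pos_lt, pos_self, pos_succ, pos_gt,
      Nat.add_sub_cancel, Nat.sub_add_cancel, mul_one, one_mul, mul_assoc]
  | h1 => simp [del_one, dup_one]
  | hm a b ha hb =>
    have := ends_dup_b a i i
    rw [Fin.succAbove_succ_self, Fin.succAbove_succ_self] at this
    rw [dup_mul, del_mul, ha, this, hb]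
  | hi a ha =>
    have := ends_dup_b a⁻¹ i i
    rw [Fin.succAbove_succ_self, Fin.succAbove_succ_self] at this
    rw [dup_inv a i, del_inv, ← dup_inv a i, this, ha]
theorem del_dup_succ (a : BraidGroup n) (i : Fin (n + 1)) : del (dup a i) i.succ = a := by
  induction a using induct generalizing i with
  | hg b hb =>
    rw [dup_gen hb]
    rcases (by omega : (i : ℕ) < b ∨ (i : ℕ) = b ∨ (i : ℕ) = b + 1 ∨ b + 1 < (i : ℕ))
      with h | h | h | h <;>
    simp (disch := first | omega |
        simp (disch := omega) only [ends_gen, pos_lt, pos_self, pos_succ, pos_gt,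
          succAbove_lt, succAbove_ge, Fin.val_castSucc, Fin.val_succ]; omega) only
      [dupGen_lt, dupGen_self, dupGen_succ, dupGen_gt, delGen_lt, delGen_self, delGen_succ,
      delGen_gt, dup_mul, dup_one, dup_gen, del_mul, del_one, del_gen, ends_gen, succAbove_lt,
      succAbove_ge, Fin.val_castSucc, Fin.val_succ, pos_lt, pos_self, pos_succ, pos_gt,
      Nat.add_sub_cancel, Nat.sub_add_cancel, mul_one, one_mul, mul_assoc]
  | h1 => simp [del_one, dup_one]
  | hm a b ha hb =>
    have := ends_dup_a a i i
    rw [Fin.succAbove_castSucc_self, Fin.succAbove_castSucc_self] at this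
    rw [dup_mul, del_mul, ha, this, hb]
  | hi a ha =>
    have := ends_dup_a a⁻¹ i i
    rw [Fin.succAbove_castSucc_self, Fin.succAbove_castSucc_self] at this
    rw [dup_inv a i, del_inv, ← dup_inv a i, this, ha]

end Basic
end BraidGroup

/-! ### The simplicial group of pure braids -/

/-- The pure braid group on `n + 1` strands: the braids whose underlying permutation is trivial. -/
def PureBraidGroup (n : ℕ) : Subgroup (BraidGroup n) := (BraidGroup.perm n).ker

namespace PureBraidGroup
open BraidGroup
variable {n : ℕ}

theorem mem_iff (a : BraidGroup n) : a ∈ PureBraidGroup n ↔ ∀ k, ends a k = k := by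
  change perm n a = 1 ↔ _
  rw [← inv_eq_one, Equiv.ext_iff]
  rfl

theorem dup_mem {a : BraidGroup n} (ha : a ∈ PureBraidGroup n) (k : Fin (n + 1)) :
    dup a k ∈ PureBraidGroup (n + 1) := by
  rw [mem_iff] at ha ⊢
  intro j
  by_cases h : j = k.castSucc
  · subst h
    have := ends_dup_b a k k
    rwa [Fin.succAbove_succ_self, ha, Fin.succAbove_succ_self] at this
  · obtain ⟨j, rfl⟩ := Fin.exists_succAbove_eq h
    rw [ends_dup_a, ha, ha]

theorem del_mem {a : BraidGroup (n + 1)} (ha : a ∈ PureBraidGroup (n + 1)) (k : Fin (n + 2)) :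
    del a k ∈ PureBraidGroup n := by
  rw [mem_iff] at ha ⊢
  intro j
  have := ends_del a k j
  rw [ha, ha] at this
  exact Fin.succAbove_right_injective this

/-- Doubling of the strand `k`, as a homomorphism of pure braid groups. -/
def dupHom (k : Fin (n + 1)) : PureBraidGroup n →* PureBraidGroup (n + 1) where
  toFun a := ⟨dup a k, dup_mem a.2 k⟩
  map_one' := Subtype.ext (dup_one k)
  map_mul' a b := Subtype.ext (by
    change dup ((a : BraidGroup n) * (b : BraidGroup n)) k = _
    rw [dup_mul, (mem_iff _).1 a.2 k]; rfl)

/-- Deletion of the strand `k`, as a homomorphism of pure braid groups. -/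
def delHom (k : Fin (n + 2)) : PureBraidGroup (n + 1) →* PureBraidGroup n where
  toFun a := ⟨del a k, del_mem a.2 k⟩
  map_one' := Subtype.ext (del_one k)
  map_mul' a b := Subtype.ext (by
    change del ((a : BraidGroup (n + 1)) * (b : BraidGroup (n + 1))) k = _
    rw [del_mul, (mem_iff _).1 a.2 k]; rfl)

theorem delHom_delHom {i j : Fin (n + 2)} (h : i ≤ j) (a : PureBraidGroup (n + 2)) :
    delHom i (delHom j.succ a) = delHom j (delHom i.castSucc a) :=
  Subtype.ext (del_del a.1 j.succ i.castSucc j i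
    (by rw [Fin.succAbove_of_castSucc_lt]; exact Fin.castSucc_lt_succ_iff.2 h)
    (by rw [Fin.succAbove_of_le_castSucc]; exact h))

theorem delHom_dupHom_of_le {i : Fin (n + 2)} {j : Fin (n + 1)} (h : i ≤ j.castSucc)
    (a : PureBraidGroup (n + 1)) :
    delHom i.castSucc (dupHom j.succ a) = dupHom j (delHom i a) := by
  have := del_dup a.1 j.succ i j (by rw [Fin.succAbove_of_le_castSucc]; exact h)
  rw [Fin.succAbove_of_castSucc_lt _ _ (by rw [Fin.castSucc_lt_castSucc_iff]; exact Fin.le_castSucc_iff.1 h)] at this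
  exact Subtype.ext this

theorem delHom_dupHom_castSucc (i : Fin (n + 1)) (a : PureBraidGroup n) :
    delHom i.castSucc (dupHom i a) = a := Subtype.ext (del_dup_castSucc a.1 i)

theorem delHom_dupHom_succ (i : Fin (n + 1)) (a : PureBraidGroup n) :
    delHom i.succ (dupHom i a) = a := Subtype.ext (del_dup_succ a.1 i)

theorem delHom_dupHom_of_gt {i : Fin (n + 2)} {j : Fin (n + 1)} (h : j.castSucc < i)
    (a : PureBraidGroup (n + 1)) :
    delHom i.succ (dupHom j.castSucc a) = dupHom j (delHom i a) := by
  have := del_dup a.1 j.castSucc i j (by rw [Fin.succAbove_of_castSucc_lt]; exact h)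
  rw [Fin.succAbove_of_le_castSucc _ _ (by rw [Fin.castSucc_le_castSucc_iff]; exact h.le)] at this
  exact Subtype.ext this

theorem dupHom_dupHom {i j : Fin (n + 1)} (h : i ≤ j) (a : PureBraidGroup n) :
    dupHom i.castSucc (dupHom j a) = dupHom j.succ (dupHom i a) := by
  have := dup_dup a.1 i j
  rw [Fin.succAbove_of_le_castSucc _ _ (by rw [Fin.castSucc_le_castSucc_iff]; exact h),
    Fin.succAbove_of_castSucc_lt _ _ (by exact Fin.castSucc_lt_succ_iff.2 h)] at this
  exact Subtype.ext this.symm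

/-- The pure braid `A_{1,2} = σ²` on two strands: a full twist. -/
def fullTwist : PureBraidGroup 1 :=
  ⟨gen 1 0 ^ 2, by
    change perm 1 (gen 1 0 ^ 2) = 1
    rw [map_pow, perm, lift_gen _ _ _ one_pos, pow_two]
    exact Equiv.swap_mul_self _ _⟩

end PureBraidGroup

open PureBraidGroup in
/-- The simplicial group `AP`: in degree `n` it is the pure braid group on the strands `0, …, n`,
the face `d_i` deletes the strand `i`, and the degeneracy `s_i` doubles the strand `i`. -/
noncomputable def AP : SimplicialObject GrpCat.{0} :=
  FacesDegeneracies.toSimplicialObject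
    { X := fun n => GrpCat.of (PureBraidGroup n)
      d := fun _ i => GrpCat.ofHom (delHom i)
      s := fun _ i => GrpCat.ofHom (dupHom i)
      dd := fun _ _ _ h => GrpCat.ext fun a => delHom_delHom h a
      sd_le := fun _ _ _ h => GrpCat.ext fun a => delHom_dupHom_of_le h a
      sd_self := fun _ i => GrpCat.ext fun a => delHom_dupHom_castSucc i a
      sd_succ := fun _ i => GrpCat.ext fun a => delHom_dupHom_succ i a
      sd_gt := fun _ _ _ h => GrpCat.ext fun a => delHom_dupHom_of_gt h a
      ss := fun _ _ _ h => GrpCat.ext fun a => dupHom_dupHom h a }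

namespace AP

theorem obj_mk (n : ℕ) : AP _⦋n⦌ = GrpCat.of (PureBraidGroup n) := rfl

theorem δ_eq {n : ℕ} (i : Fin (n + 2)) :
    AP.δ i = GrpCat.ofHom (PureBraidGroup.delHom (n := n) i) :=
  FacesDegeneracies.toSimplicialObject_δ _ i

theorem σ_eq {n : ℕ} (i : Fin (n + 1)) :
    AP.σ i = GrpCat.ofHom (PureBraidGroup.dupHom (n := n) i) :=
  FacesDegeneracies.toSimplicialObject_σ _ i

/-- The `1`-simplex `A_{1,2}` of `AP`. -/
def A₁₂ : AP _⦋1⦌ := PureBraidGroup.fullTwist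

end AP

/-! ### Milnor's construction and the simplicial circle -/

/-- The degenerate simplices of a base point `x` of a simplicial set. -/
def SSet.basepoint (X : SSet.{u}) (x : X _⦋0⦌) (n : SimplexCategoryᵒᵖ) : X.obj n :=
  X.map (n.unop.const ⦋0⦌ 0).op x

theorem SSet.map_basepoint (X : SSet.{u}) (x : X _⦋0⦌) {n m : SimplexCategoryᵒᵖ} (f : n ⟶ m) :
    X.map f (X.basepoint x n) = X.basepoint x m := by
  unfold SSet.basepoint
  rw [← CategoryTheory.comp_apply, ← Functor.map_comp]
  rfl

/-- Milnor's construction `F[X]` on a simplicial set `X` with base point `x`: in degree `n` it is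
the group generated by the `n`-simplices of `X`, with the only relation that the (degenerate) base
point is `1`. -/
def MilnorF (X : SSet.{u}) (x : X _⦋0⦌) : SimplicialObject GrpCat.{u} where
  obj n := GrpCat.of (PresentedGroup {FreeGroup.of (X.basepoint x n)})
  map {n m} f := GrpCat.ofHom (PresentedGroup.map (FreeGroup.map (X.map f)) (by
    rintro _ rfl
    rw [FreeGroup.map.of, X.map_basepoint]
    exact rfl))
  map_id n := by
    refine GrpCat.hom_ext (PresentedGroup.ext fun y => ?_)
    change PresentedGroup.mk _ (FreeGroup.map (X.map (𝟙 n)) (FreeGroup.of y)) = _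
    rw [FreeGroup.map.of, X.map_id]
    rfl
  map_comp {n m k} f g := by
    refine GrpCat.hom_ext (PresentedGroup.ext fun y => ?_)
    change PresentedGroup.mk _ (FreeGroup.map (X.map (f ≫ g)) (FreeGroup.of y)) = 
      PresentedGroup.mk _ (FreeGroup.map (X.map g) (FreeGroup.map (X.map f) (FreeGroup.of y)))
    rw [FreeGroup.map.of, FreeGroup.map.of, FreeGroup.map.of, X.map_comp]
    rfl

/-- The generator of `F[X]_n` given by an `n`-simplex of `X`. -/
def MilnorF.of {X : SSet.{u}} {x : X _⦋0⦌} {n : SimplexCategoryᵒᵖ} (y : X.obj n) :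
    (MilnorF X x).obj n :=
  (PresentedGroup.of y : PresentedGroup {FreeGroup.of (X.basepoint x n)})

namespace SSet.S1

/-- The quotient map from the standard `1`-simplex to the simplicial circle. -/
noncomputable def proj : Δ[1] ⟶ SSet.S1 :=
  Limits.coequalizer.π (stdSimplex.δ 0 : Δ[0] ⟶ Δ[1]) (stdSimplex.δ 1)

/-- The nondegenerate `1`-simplex of the simplicial circle. -/
noncomputable def z : SSet.S1 _⦋1⦌ := yonedaEquiv proj

/-- The vertex of the simplicial circle. -/
noncomputable def pt : SSet.S1 _⦋0⦌ := SSet.S1.δ 0 z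

/-- The simplices `z_1, …, z_n` of degree `n`: `z_{i+1}` is `s_0 ^ i s_1 ^ (n - 1 - i) z`, that is,
the pullback of `z` along the monotone map `{0, …, n} → {0, 1}` which takes the value `0` exactly
on `{0, …, i}`. -/
noncomputable def zSimplex (n : ℕ) (i : Fin n) : SSet.S1 _⦋n⦌ :=
  SSet.S1.map (SimplexCategory.toMk₁ i.succ.castSucc).op z

end SSet.S1

/-- The simplicial group `F[S¹]`. -/
noncomputable abbrev FS1 : SimplicialObject GrpCat.{0} := MilnorF SSet.S1 SSet.S1.pt

/-!
Existence and uniqueness of `Θ` follow from the universal property of Milnor's construction: the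
circle is generated by the simplex `z`, with the only relation that its two faces agree, and
the pure braid group on one strand is trivial. The simplices of the circle in degree `n` are
the base point and `z_1, …, z_n`, so `F[S¹]_n` is generated by the latter. All other assertions
follow from the injectivity of the composite `F(z_1, …, z_n) → F[S¹]_n → P_{n+1}`, which is proved
as follows.

* Since `Θ` commutes with degeneracies, `Θ(z_{i+1})` is a full twist of two cables, which consist of
  the strands `0, …, i` and `i + 1, …, n`. The braid group acts by Hurwitz moves on sequences of
  elements of a group, and, more precisely, on sequences of cables, which record the conjugating
  elements. This action is compatible with the doubling of strands (`Cable.join_hurwitz_dup`), so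
  that the action of such a twist is known (`Cable.IsTwist.dup`).
* Take strands labelled by elements of a free group on `Y_0, …, Y_{n-1}` such that the product of
  the first `i + 1` labels is `Y_i` and the product of all labels is `1`. Then the generator
  `z_{i+1}` acts on this free group by the automorphism which conjugates `Y_j` by `Y_i` for `j < i`
  and by `Y_i⁻¹` for `j > i`, and the conjugating elements of the last strand form a crossed
  homomorphism `e` with `e(z_{i+1}) = Y_i`. If `Θ(v) = 1`, then `e(v) = 1`
  (`TwistedFree.injective_of_isTwist`).
* The crossed homomorphism `e` has trivial kernel (`TwistedFree.isFaithful_orderSign`). This is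
  proved by induction on `n`, simultaneously for the crossed homomorphism with the values `Y_i⁻¹`.
  One of the generators, the first or the last one, acts trivially up to an inner automorphism.
  By induction an element of the kernel is a product of conjugates of this generator or its inverse
  by elements `v` of the free group on the others. On such products the inverse of `e` is
  a homomorphism, which maps these conjugates to conjugates of one `Y` by the values at `v` of the
  crossed homomorphism with the other sign. By induction these values are
  distinct modulo `Y`, hence the conjugates are independent (`IsFaithful.option`).
* The independence holds because arbitrary conjugates of the generators of a free group are
  independent (`FreeGroup.injective_lift_conj`), which follows from the residual nilpotence of free
  groups (`FreeGroup.eq_one_of_mem_lowerCentralSeries`), proved by Magnus' representation by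
  power series.
-/

/-! ### Residual nilpotence of free groups -/

open scoped commutatorElement

namespace MagnusAction

variable {S : Type*}

/-- Noncommutative power series with integral coefficients in variables `X_s`, encoded by their
coefficients. -/
abbrev Series (S : Type*) : Type _ := List S → ℤ

section Variables
variable [DecidableEq S]

/-- Left multiplication by `(1 + X_s)⁻¹` on noncommutative power series. -/
def invMul (s : S) (f : Series S) (c : List S) : ℤ :=
  match c with
  | [] => f []
  | a :: c => f (a :: c) - if a = s then invMul s f c else 0

/-- Left multiplication by `1 + X_s` on noncommutative power series. -/
def mul (s : S) (f : Series S) (c : List S) : ℤ :=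
  match c with
  | [] => f []
  | a :: c => f (a :: c) + if a = s then f c else 0

/-- Left multiplication by `1 + X_s`, as an automorphism. -/
def mulVar (s : S) : Series S ≃ₗ[ℤ] Series S where
  toFun := mul s
  invFun := invMul s
  left_inv f := by
    funext c
    induction c with
    | nil => rfl
    | cons a c ih => simp only [invMul, mul, ih]; ring
  right_inv f := by
    funext c
    cases c with
    | nil => rfl
    | cons a c => simp only [invMul, mul]; ring
  map_add' f g := by
    funext c
    cases c with
    | nil => rfl
    | cons a c => simp only [mul, Pi.add_apply]; split_ifs <;> ring
  map_smul' m f := by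
    funext c
    cases c with
    | nil => rfl
    | cons a c =>
      simp only [mul, Pi.smul_apply, smul_eq_mul, RingHom.id_apply]; split_ifs <;> ring

theorem mulVar_cons (s a : S) (f : Series S) (c : List S) :
    mulVar s f (a :: c) = f (a :: c) + if a = s then f c else 0 := rfl

theorem mulVar_nil (s : S) (f : Series S) : mulVar s f [] = f [] := rfl

theorem mulVar_inv_cons (s a : S) (f : Series S) (c : List S) :
    (mulVar s)⁻¹ f (a :: c) = f (a :: c) - if a = s then (mulVar s)⁻¹ f c else 0 := rfl

theorem mulVar_inv_nil (s : S) (f : Series S) : (mulVar s)⁻¹ f [] = f [] := rfl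

/-- The coefficients of `(1 + X_s) ^ m * f` at the words `c` and `s :: c`, where `c` does not begin
with `s`. -/
theorem mulVar_zpow (s : S) (m : ℤ) (f : Series S) (c : List S) (hc : ∀ a ∈ c.head?, a ≠ s) :
    (mulVar s ^ m) f c = f c ∧ (mulVar s ^ m) f (s :: c) = f (s :: c) + m * f c := by
  have h1 : ∀ g : Series S, mulVar s g c = g c := by
    intro g
    cases c with
    | nil => rfl
    | cons a c => rw [mulVar_cons, if_neg (hc a (by simp)), add_zero]
  have h2 : ∀ g : Series S, (mulVar s)⁻¹ g c = g c := by
    intro g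
    cases c with
    | nil => rfl
    | cons a c => rw [mulVar_inv_cons, if_neg (hc a (by simp)), sub_zero]
  induction m using Int.induction_on generalizing f with
  | zero => simp
  | succ m ih =>
    rw [zpow_add_one, LinearEquiv.mul_apply, (ih _).1, (ih _).2, h1, mulVar_cons, if_pos rfl]
    exact ⟨rfl, by push_cast; ring⟩
  | pred m ih =>
    rw [zpow_sub_one, LinearEquiv.mul_apply, (ih _).1, (ih _).2, h2, mulVar_inv_cons, if_pos rfl, h2]
    exact ⟨rfl, by push_cast; ring⟩

end Variables

theorem apply_inv_apply (g : Series S ≃ₗ[ℤ] Series S) (f : Series S) : g (g⁻¹ f) = f :=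
  g.apply_symm_apply f

/-- The power series of order at least `i`. -/
def order (S : Type*) (i : ℕ) : AddSubgroup (Series S) where
  carrier := {f | ∀ c, c.length < i → f c = 0}
  zero_mem' _ _ := rfl
  add_mem' hf hg c hc := by rw [Pi.add_apply, hf c hc, hg c hc, add_zero]
  neg_mem' hf c hc := by rw [Pi.neg_apply, hf c hc, neg_zero]

theorem order_anti {S : Type*} {i j : ℕ} (h : i ≤ j) : order S j ≤ order S i :=
  fun _ hf c hc => hf c (by omega)

/-- The automorphisms of the space of power series which raise the order by at least `k` after
subtraction of the identity, as do their inverses. -/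
def raising (S : Type*) (k : ℕ) : Subgroup (Series S ≃ₗ[ℤ] Series S) where
  carrier := {g | ∀ i, ∀ f ∈ order S i, g f - f ∈ order S (i + k) ∧ g⁻¹ f - f ∈ order S (i + k)}
  one_mem' i f _ := by simp [zero_mem]
  mul_mem' {g h} hg hh i f hf := by
    have key : ∀ g h : Series S ≃ₗ[ℤ] Series S, (g (h f) - h f ∈ order S (i + k)) →
        h f - f ∈ order S (i + k) → (g * h) f - f ∈ order S (i + k) := by
      intro g h h1 h2
      have := add_mem h1 h2
      rwa [sub_add_sub_cancel] at this
    have pres : ∀ h : Series S ≃ₗ[ℤ] Series S, h f - f ∈ order S (i + k) → h f ∈ order S i := by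
      intro h h1
      have := add_mem (order_anti (Nat.le_add_right i k) h1) hf
      rwa [sub_add_cancel] at this
    refine ⟨key g h (hg i _ (pres h (hh i f hf).1)).1 (hh i f hf).1, ?_⟩
    rw [mul_inv_rev]
    exact key h⁻¹ g⁻¹ (hh i _ (pres g⁻¹ (hg i f hf).2)).2 (hg i f hf).2
  inv_mem' hg i f hf := ⟨(hg i f hf).2, by rw [inv_inv]; exact (hg i f hf).1⟩

theorem apply_mem_order {k : ℕ} {g : Series S ≃ₗ[ℤ] Series S} (hg : g ∈ raising S k) {i : ℕ}
    {f : Series S} (hf : f ∈ order S i) : g f ∈ order S i := by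
  have := add_mem (order_anti (Nat.le_add_right i k) (hg i f hf).1) hf
  rwa [sub_add_cancel] at this

theorem commutator_apply_sub_mem {k l : ℕ} {g h : Series S ≃ₗ[ℤ] Series S} (hg : g ∈ raising S k)
    (hh : h ∈ raising S l) {i : ℕ} {f : Series S} (hf : f ∈ order S i) :
    ⁅g, h⁆ f - f ∈ order S (i + (k + l)) := by
  -- `⁅g, h⁆ f - f = (g h - h g) e = (g - 1) (h - 1) e - (h - 1) (g - 1) e`, `e = g⁻¹ h⁻¹ f`
  set e := g⁻¹ (h⁻¹ f) with he
  have hfe : f = h (g e) := by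
    rw [he, apply_inv_apply, apply_inv_apply]
  have hemem : e ∈ order S i :=
    apply_mem_order (inv_mem hg) (apply_mem_order (inv_mem hh) hf)
  have h1 := (hg _ _ (hh i e hemem).1).1
  have h2 := (hh _ _ (hg i e hemem).1).1
  rw [add_assoc, add_comm l k] at h1
  rw [add_assoc] at h2
  have h3 := sub_mem h1 h2
  have : ⁅g, h⁆ f = g (h e) := by
    rw [commutatorElement_def, LinearEquiv.mul_apply, LinearEquiv.mul_apply, LinearEquiv.mul_apply]
  rw [this]
  rw [map_sub, map_sub] at h3
  convert h3 using 1
  nth_rewrite 1 [hfe]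
  abel

theorem commutator_mem_raising {k l : ℕ} {g h : Series S ≃ₗ[ℤ] Series S} (hg : g ∈ raising S k)
    (hh : h ∈ raising S l) : ⁅g, h⁆ ∈ raising S (k + l) := fun _ _ hf =>
  ⟨commutator_apply_sub_mem hg hh hf, by
    rw [commutatorElement_inv, add_comm k l]; exact commutator_apply_sub_mem hh hg hf⟩

variable [DecidableEq S]

theorem mulVar_mem_raising (s : S) : mulVar s ∈ raising S 1 := by
  intro i f hf
  refine ⟨fun c hc => ?_, fun c hc => ?_⟩
  · cases c with
    | nil => rw [Pi.sub_apply, mulVar_nil, sub_self]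
    | cons a c =>
      rw [List.length_cons] at hc
      rw [Pi.sub_apply, mulVar_cons, hf c (by omega), ite_self, add_zero, sub_self]
  · have key : ∀ c : List S, c.length < i → (mulVar s)⁻¹ f c = 0 := by
      intro c
      induction c with
      | nil => intro hc; rw [mulVar_inv_nil, hf _ hc]
      | cons a c ih =>
        intro hc
        rw [mulVar_inv_cons, ih (by rw [List.length_cons] at hc; omega), ite_self, sub_zero, hf _ hc]
    cases c with
    | nil => rw [Pi.sub_apply, mulVar_inv_nil, sub_self]
    | cons a c =>
      rw [List.length_cons] at hc
      rw [Pi.sub_apply, mulVar_inv_cons, key c (by omega), ite_self, sub_zero, sub_self]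

/-- The Magnus representation: the generator `s` of the free group acts as `1 + X_s`. -/
def rep (S : Type*) [DecidableEq S] : FreeGroup S →* (Series S ≃ₗ[ℤ] Series S) :=
  FreeGroup.lift mulVar

theorem rep_mem_raising (w : FreeGroup S) : rep S w ∈ raising S 1 := by
  induction w using FreeGroup.induction_on with
  | C1 => rw [map_one]; exact one_mem _
  | of s => rw [rep, FreeGroup.lift_apply_of]; exact mulVar_mem_raising s
  | inv_of s ih => rw [map_inv]; exact inv_mem ih
  | mul x y hx hy => rw [map_mul]; exact mul_mem hx hy

/-- The Magnus representation maps the lower central series to the filtration by `raising`. -/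
theorem lowerCentralSeries_le_raising (k : ℕ) :
    (⊤ : Subgroup (FreeGroup S)).lowerCentralSeries k ≤ (raising S (k + 1)).comap (rep S) := by
  induction k with
  | zero => exact fun w _ => rep_mem_raising w
  | succ k ih =>
    rw [Subgroup.lowerCentralSeries_succ, Subgroup.commutator_le]
    intro a ha b _
    have := commutator_mem_raising (ih ha) (rep_mem_raising b)
    rw [← map_commutatorElement] at this
    exact this

/-- The power series `(1 + X_{s_1}) ^ m_1 * … * (1 + X_{s_r}) ^ m_r`. -/
def series (l : List (S × ℤ)) : Series S :=
  match l with
  | [] => Pi.single [] 1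
  | x :: l => (mulVar x.1 ^ x.2) (series l)

/-- A product of `r` powers of variables has only terms with at most `r` syllables. -/
theorem series_eq_zero (l : List (S × ℤ)) (c : List S) (hc : c.IsChain (· ≠ ·))
    (h : l.length < c.length) : series l c = 0 := by
  induction l generalizing c with
  | nil =>
    exact Pi.single_eq_of_ne (by rintro rfl; simp at h) 1
  | cons x l ih =>
    rw [List.length_cons] at h
    obtain _ | ⟨a, c⟩ := c
    · simp at h
    rw [List.length_cons] at h
    rw [List.isChain_cons] at hc
    by_cases ha : a = x.1
    · subst ha
      rw [series, (mulVar_zpow x.1 x.2 _ c fun b hb => (hc.1 b hb).symm).2, ih c hc.2 (by omega),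
        ih _ (List.isChain_cons.2 hc) (by rw [List.length_cons]; omega), mul_zero, add_zero]
    · rw [series, (mulVar_zpow x.1 x.2 _ (a :: c) (by simpa using ha)).1]
      exact ih _ (List.isChain_cons.2 hc) (by rw [List.length_cons]; omega)

/-- The coefficient at the word `s_1 … s_r` is `m_1 * … * m_r`; it shows that a reduced product of
`r ≥ 1` nontrivial powers acts nontrivially. -/
theorem series_letters (l : List (S × ℤ)) (hl : l.IsChain fun x y => x.1 ≠ y.1) :
    series l (l.map Prod.fst) = (l.map Prod.snd).prod := by
  induction l with
  | nil => simp [series]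
  | cons x l ih =>
    have hc : (l.map Prod.fst).IsChain (· ≠ ·) := by
      rw [List.isChain_map]; exact (List.isChain_cons.1 hl).2
    have hc' : ((x :: l).map Prod.fst).IsChain (· ≠ ·) := by
      rw [List.isChain_map]; exact hl
    rw [List.map_cons] at hc'
    have hx := (List.isChain_cons.1 hc').1
    rw [List.map_cons, List.map_cons, List.prod_cons, series,
      (mulVar_zpow x.1 x.2 _ _ fun b hb => (hx b hb).symm).2, ih (List.isChain_cons.1 hl).2,
      series_eq_zero l _ hc' (by simp), zero_add]

end MagnusAction

/-- Every element of a free group is a product of nontrivial powers of generators, in which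
neighbouring generators are distinct. -/
theorem FreeGroup.exists_syllables {S : Type*} (w : FreeGroup S) :
    ∃ l : List (S × ℤ), (l.IsChain fun x y => x.1 ≠ y.1) ∧ (∀ x ∈ l, x.2 ≠ 0) ∧
      w = (l.map fun x => FreeGroup.of x.1 ^ x.2).prod := by
  classical
  let A : FreeGroup S →* Monoid.CoprodI fun _ : S => Multiplicative ℤ :=
    FreeGroup.lift fun s => Monoid.CoprodI.of (i := s) (Multiplicative.ofAdd 1)
  let B : (Monoid.CoprodI fun _ : S => Multiplicative ℤ) →* FreeGroup S :=
    Monoid.CoprodI.lift fun s => zpowersHom _ (FreeGroup.of s)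
  have hBA : B.comp A = MonoidHom.id _ := by
    ext s
    simp [A, B]
  let W := Monoid.CoprodI.Word.equiv (A w)
  have hW : W.prod = A w := Monoid.CoprodI.Word.equiv.symm_apply_apply (A w)
  refine ⟨W.toList.map fun x => (x.1, x.2.toAdd), ?_, ?_, ?_⟩
  · rw [List.isChain_map]
    exact W.chain_ne
  · intro x hx
    obtain ⟨y, hy, rfl⟩ := List.mem_map.1 hx
    exact fun h => W.ne_one y hy h
  · have h1 := DFunLike.congr_fun hBA w
    rw [MonoidHom.comp_apply, ← hW, Monoid.CoprodI.Word.prod, map_list_prod, List.map_map] at h1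
    rw [List.map_map, ← MonoidHom.id_apply (FreeGroup S) w, ← h1]
    congr 1

/-- Magnus' theorem that free groups are residually nilpotent. -/
theorem FreeGroup.eq_one_of_mem_lowerCentralSeries {S : Type*} (w : FreeGroup S)
    (h : ∀ k, w ∈ (⊤ : Subgroup (FreeGroup S)).lowerCentralSeries k) : w = 1 := by
  classical
  obtain ⟨l, hl, h0, hw⟩ := w.exists_syllables
  have hs : ∀ l : List (S × ℤ), MagnusAction.rep S (l.map fun x => FreeGroup.of x.1 ^ x.2).prod
      (MagnusAction.series []) = MagnusAction.series l := by
    intro l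
    induction l with
    | nil => simp
    | cons x l ih =>
      rw [List.map_cons, List.prod_cons, _root_.map_mul, LinearEquiv.mul_apply, ih, _root_.map_zpow,
        MagnusAction.rep, FreeGroup.lift_apply_of]
      rfl
  have h1 := MagnusAction.lowerCentralSeries_le_raising _ (h l.length) 0
    (MagnusAction.series []) (fun c hc => by omega)
  have h2 := h1.1 (l.map Prod.fst) (by simp)
  rw [hw, hs, Pi.sub_apply, MagnusAction.series_letters l hl] at h2
  obtain _ | ⟨x, l⟩ := l
  · simpa using hw
  · exfalso
    rw [show MagnusAction.series ([] : List (S × ℤ)) ((x :: l).map Prod.fst) = 0 from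
      Pi.single_eq_of_ne (by simp) 1, sub_zero, List.prod_eq_zero_iff] at h2
    obtain ⟨y, hy, hy0⟩ := List.mem_map.1 h2
    exact h0 y hy hy0

theorem commutatorElement_mul_left_eq {G : Type*} [Group G] {z a b : G}
    (h : z * (a * b * a⁻¹) = a * b * a⁻¹ * z) : ⁅z * a, b⁆ = ⁅a, b⁆ := by
  rw [commutatorElement_def, commutatorElement_def, mul_inv_rev]
  calc z * a * b * (a⁻¹ * z⁻¹) * b⁻¹ = z * (a * b * a⁻¹) * z⁻¹ * b⁻¹ := by group
    _ = _ := by rw [h]; group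

theorem commutatorElement_mul_right_eq {G : Type*} [Group G] {a b c : G}
    (h : a * c = c * a) (h' : c * ⁅a, b⁆ = ⁅a, b⁆ * c) : ⁅a, c * b⁆ = ⁅a, b⁆ := by
  calc ⁅a, c * b⁆ = a * c * b * a⁻¹ * b⁻¹ * c⁻¹ := by rw [commutatorElement_def]; group
    _ = c * ⁅a, b⁆ * c⁻¹ := by rw [h, commutatorElement_def]; group
    _ = _ := by rw [h']; group

/-- An endomorphism which is trivial on the abelianization is trivial on the quotients of
the lower central series. -/
theorem MonoidHom.map_mul_inv_mem_lowerCentralSeries {G : Type*} [Group G] (θ : G →* G)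
    (h : ∀ g, θ g * g⁻¹ ∈ (⊤ : Subgroup G).lowerCentralSeries 1) (k : ℕ) (g : G)
    (hg : g ∈ (⊤ : Subgroup G).lowerCentralSeries k) :
    θ g * g⁻¹ ∈ (⊤ : Subgroup G).lowerCentralSeries (k + 1) := by
  induction k generalizing g with
  | zero => exact h g
  | succ k ih =>
    let N := (⊤ : Subgroup G).lowerCentralSeries (k + 1 + 1)
    have hN : ∀ x, QuotientGroup.mk' N x = 1 ↔ x ∈ N := fun x => QuotientGroup.eq_one_iff x
    have hsurj := QuotientGroup.mk'_surjective N
    set q := QuotientGroup.mk' N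
    have hcent : ∀ x ∈ (⊤ : Subgroup G).lowerCentralSeries (k + 1), ∀ y, q x * y = y * q x := by
      intro x hx y
      obtain ⟨y, rfl⟩ := hsurj y
      rw [← commutatorElement_eq_one_iff_mul_comm, ← map_commutatorElement, hN]
      exact Subgroup.commutator_mem_commutator hx trivial
    -- modulo the term `k + 2`, the term `k` commutes with commutators, since commutation with one
    -- of its elements is a homomorphism to the abelian group of the classes of the term `k + 1`
    have hcomm : ∀ x ∈ (⊤ : Subgroup G).lowerCentralSeries k,
        ∀ y ∈ (⊤ : Subgroup G).lowerCentralSeries 1, q x * q y = q y * q x := by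
      intro x hx y hy
      have hle : (⊤ : Subgroup G).lowerCentralSeries 1 ≤
          (Subgroup.centralizer {q x}).comap q := by
        rw [Subgroup.lowerCentralSeries_succ, Subgroup.commutator_le]
        intro a _ b _
        have key : ∀ a, ∃ z, (∀ y, z * y = y * z) ∧ q x * q a * (q x)⁻¹ = z * q a :=
          fun a => ⟨q ⁅x, a⁆, hcent _ (Subgroup.commutator_mem_commutator hx trivial), by
            rw [map_commutatorElement, commutatorElement_def]; group⟩
        obtain ⟨z, hz, hz'⟩ := key a
        obtain ⟨t, ht, ht'⟩ := key b
        rw [Subgroup.mem_comap, Subgroup.mem_centralizer_singleton_iff, map_commutatorElement]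
        refine (mul_inv_eq_iff_eq_mul.1 ?_).symm
        calc q x * ⁅q a, q b⁆ * (q x)⁻¹
            = ⁅q x * q a * (q x)⁻¹, q x * q b * (q x)⁻¹⁆ := by
              simp only [commutatorElement_def]; group
          _ = ⁅q a, q b⁆ := by
              rw [hz', ht', commutatorElement_mul_left_eq (hz _),
                commutatorElement_mul_right_eq (ht _).symm (ht _)]
      exact (Subgroup.mem_centralizer_singleton_iff.1 (Subgroup.mem_comap.1 (hle hy))).symm
    suffices hle : (⊤ : Subgroup G).lowerCentralSeries (k + 1) ≤ (q.comp θ).eqLocus q by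
      have h1 : q (θ g) = q g := hle hg
      rw [← hN, map_mul, map_inv, h1, mul_inv_cancel]
    rw [Subgroup.lowerCentralSeries_succ, Subgroup.commutator_le]
    intro a ha b _
    change q (θ ⁅a, b⁆) = q ⁅a, b⁆
    obtain ⟨z, hz, hz'⟩ : ∃ z ∈ (⊤ : Subgroup G).lowerCentralSeries (k + 1), θ a = z * a :=
      ⟨_, ih a ha, by group⟩
    obtain ⟨c, hc, hc'⟩ : ∃ c ∈ (⊤ : Subgroup G).lowerCentralSeries 1, θ b = c * b :=
      ⟨_, h b, by group⟩
    have h1 := hcent ⁅a, b⁆ (Subgroup.commutator_mem_commutator ha trivial) (q c)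
    rw [map_commutatorElement] at h1
    rw [map_commutatorElement, map_commutatorElement, map_commutatorElement, hz', hc', map_mul,
      map_mul, commutatorElement_mul_left_eq (hcent z hz _),
      commutatorElement_mul_right_eq (hcomm a ha c hc) h1.symm]

/-- Arbitrary conjugates of the generators of a free group are independent: the endomorphism which
they define is trivial on the abelianization, hence on the quotients of the lower central series,
so that its kernel lies in all terms of this series. -/
theorem FreeGroup.injective_lift_conj {S : Type*} (x : S → FreeGroup S) :
    Function.Injective (FreeGroup.lift fun s => (x s)⁻¹ * FreeGroup.of s * x s) := by
  set θ := FreeGroup.lift fun s => (x s)⁻¹ * FreeGroup.of s * x s with hθ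
  rw [injective_iff_map_eq_one]
  intro w hw
  refine w.eq_one_of_mem_lowerCentralSeries fun k => ?_
  induction k with
  | zero => trivial
  | succ k ih =>
    have := θ.map_mul_inv_mem_lowerCentralSeries (fun g => ?_) k w ih
    · rwa [hw, one_mul, inv_mem_iff] at this
    · rw [Subgroup.top_lowerCentralSeries_one, ← QuotientGroup.eq_one_iff, QuotientGroup.mk_mul,
        QuotientGroup.mk_inv, mul_inv_eq_one]
      change Abelianization.of (θ g) = Abelianization.of g
      have : Abelianization.of.comp θ = Abelianization.of := by
        ext s
        simp [hθ]
      exact DFunLike.congr_fun this g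

/-! ### Crossed homomorphisms between free groups -/

namespace TwistedFree

variable {I : Type*} (ε : I → I → ℤ)

/-- The endomorphism `Y_j ↦ Y_i ^ (ε i j) * Y_j * Y_i ^ (-ε i j)` of the free group on the generators
`Y_j`. The value `ε i i` is irrelevant. -/
def conjHom (i : I) : FreeGroup I →* FreeGroup I :=
  FreeGroup.lift fun j => FreeGroup.of i ^ ε i j * FreeGroup.of j * (FreeGroup.of i ^ ε i j)⁻¹

theorem conjHom_of (i j : I) : conjHom ε i (FreeGroup.of j) =
    FreeGroup.of i ^ ε i j * FreeGroup.of j * (FreeGroup.of i ^ ε i j)⁻¹ :=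
  FreeGroup.lift_apply_of

theorem conjHom_self (i : I) : conjHom ε i (FreeGroup.of i) = FreeGroup.of i := by
  rw [conjHom_of, mul_inv_eq_iff_eq_mul, ← zpow_add_one, ← zpow_one_add, add_comm]

theorem conjHom_neg_comp (i : I) : (conjHom (-ε) i).comp (conjHom ε i) = MonoidHom.id _ := by
  ext j
  rw [MonoidHom.comp_apply, conjHom_of, map_mul, map_mul, map_inv, map_zpow, conjHom_self,
    conjHom_of, Pi.neg_apply, Pi.neg_apply, MonoidHom.id_apply]
  group

/-- The automorphism `Y_j ↦ Y_i ^ (ε i j) * Y_j * Y_i ^ (-ε i j)`. -/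
def conjAut (i : I) : MulAut (FreeGroup I) :=
  MonoidHom.toMulEquiv (conjHom ε i) (conjHom (-ε) i) (conjHom_neg_comp ε i)
    (by simpa using conjHom_neg_comp (-ε) i)

theorem conjAut_of (i j : I) : conjAut ε i (FreeGroup.of j) =
    FreeGroup.of i ^ ε i j * FreeGroup.of j * (FreeGroup.of i ^ ε i j)⁻¹ :=
  conjHom_of ε i j

/-- The action of the free group on itself in which the generator `i` acts as `conjAut ε i`. -/
def act : FreeGroup I →* MulAut (FreeGroup I) := FreeGroup.lift (conjAut ε)

theorem act_of (i : I) : act ε (FreeGroup.of i) = conjAut ε i := FreeGroup.lift_apply_of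

/-- For `f : I → FreeGroup I`, the homomorphism to the semidirect product that encodes
the crossed homomorphism `e` with respect to the action `act ε`, that is,
`e (u * v) = e u * act ε u (e v)`, with the values `f` at the generators. -/
def crossed (f : I → FreeGroup I) :
    FreeGroup I →* FreeGroup I ⋊[MonoidHom.id _] MulAut (FreeGroup I) :=
  FreeGroup.lift fun i => ⟨f i, conjAut ε i⟩

/-- The crossed homomorphism with respect to the action `act ε`, with the values `f` at the
generators. -/
def cocycle (f : I → FreeGroup I) (u : FreeGroup I) : FreeGroup I := (crossed ε f u).left

variable (f : I → FreeGroup I)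

theorem crossed_right (u : FreeGroup I) : (crossed ε f u).right = act ε u := by
  change (SemidirectProduct.rightHom.comp (crossed ε f)) u = act ε u
  congr 1
  ext i : 1
  rw [MonoidHom.comp_apply, crossed, FreeGroup.lift_apply_of, act_of]
  rfl

theorem cocycle_one : cocycle ε f 1 = 1 := by rw [cocycle, map_one]; rfl

theorem cocycle_of (i : I) : cocycle ε f (FreeGroup.of i) = f i := by
  rw [cocycle, crossed, FreeGroup.lift_apply_of]

theorem cocycle_mul (u v : FreeGroup I) :
    cocycle ε f (u * v) = cocycle ε f u * act ε u (cocycle ε f v) := by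
  rw [cocycle, map_mul, SemidirectProduct.mul_left, crossed_right]
  rfl

theorem act_cocycle_inv (u : FreeGroup I) :
    act ε u (cocycle ε f u⁻¹) = (cocycle ε f u)⁻¹ := by
  have := cocycle_mul ε f u u⁻¹
  rw [mul_inv_cancel, cocycle_one] at this
  exact (inv_eq_of_mul_eq_one_right this.symm).symm

theorem act_act_inv (u x : FreeGroup I) : act ε u (act ε u⁻¹ x) = x := by
  rw [← MulAut.mul_apply, ← map_mul, mul_inv_cancel, map_one, MulAut.one_apply]

theorem injective_of_eq_one (h : ∀ u, cocycle ε f u = 1 → u = 1) :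
    Function.Injective (cocycle ε f) := by
  intro u v huv
  have h1 : cocycle ε f (u⁻¹ * v) = 1 := by
    apply (act ε u).injective
    have := cocycle_mul ε f u (u⁻¹ * v)
    rw [mul_inv_cancel_left, ← huv] at this
    rw [map_one]
    exact (mul_eq_left.1 this.symm)
  exact (inv_mul_eq_one.1 (h _ h1))

/-- If `act ε u y` is `y` conjugated by the inverse of a cocycle when `u` is a generator, then so it
is for all `u`. -/
theorem act_eq_conj (y : FreeGroup I)
    (h : ∀ i, conjAut ε i y = (f i)⁻¹ * y * f i) (u : FreeGroup I) :
    act ε u y = (cocycle ε f u)⁻¹ * y * cocycle ε f u := by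
  induction u using FreeGroup.induction_on with
  | C1 => rw [map_one, cocycle_one]; simp
  | of i => rw [act_of, cocycle_of, h]
  | inv_of i ih =>
    apply (act ε (FreeGroup.of i)).injective
    rw [act_act_inv, map_mul, map_mul, map_inv, act_cocycle_inv, ih]
    group
  | mul u v hu hv =>
    rw [map_mul, MulAut.mul_apply, hv, map_mul, map_mul, map_inv, hu, cocycle_mul]
    group

/-! ### Elimination of one generator -/

section Elimination

variable (ε : Option I → Option I → ℤ)

/-- The homomorphism which kills the generator `none`. -/
def kill : FreeGroup (Option I) →* FreeGroup I :=
  FreeGroup.lift fun o => o.elim 1 FreeGroup.of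

theorem kill_none : kill (FreeGroup.of (none : Option I)) = 1 := FreeGroup.lift_apply_of

theorem kill_some (i : I) : kill (FreeGroup.of (some i)) = FreeGroup.of i := FreeGroup.lift_apply_of

/-- The inclusion of the free group on the generators other than `none`. -/
def incl : FreeGroup I →* FreeGroup (Option I) := FreeGroup.map some

theorem kill_incl (v : FreeGroup I) : kill (incl v) = v := by
  have : (kill.comp incl : FreeGroup I →* FreeGroup I) = MonoidHom.id _ := by
    ext i
    rw [MonoidHom.comp_apply, incl, FreeGroup.map.of, kill_some]
    rfl
  exact DFunLike.congr_fun this v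

/-- The restriction of the exponents to the indices other than `none`. -/
def restr (i j : I) : ℤ := ε (some i) (some j)

theorem kill_act (u x : FreeGroup (Option I)) :
    kill (act ε u x) = act (restr ε) (kill u) (kill x) := by
  induction u using FreeGroup.induction_on generalizing x with
  | C1 => simp
  | of o =>
    have : kill.comp (conjAut ε o).toMonoidHom =
        (act (restr ε) (kill (FreeGroup.of o))).toMonoidHom.comp kill := by
      ext p
      change kill (conjAut ε o (FreeGroup.of p)) =
        act (restr ε) (kill (FreeGroup.of o)) (kill (FreeGroup.of p))
      rw [conjAut_of, map_mul, map_mul, map_inv, map_zpow]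
      cases o with
      | none => rw [kill_none]; simp
      | some i =>
        cases p with
        | none => rw [kill_none]; simp
        | some j => rw [kill_some, kill_some, act_of, conjAut_of]; rfl
    rw [act_of]
    exact DFunLike.congr_fun this x
  | inv_of o ih =>
    apply (act (restr ε) (kill (FreeGroup.of o))).injective
    rw [← ih, act_act_inv, map_inv, act_act_inv]
  | mul u v hu hv =>
    rw [map_mul, MulAut.mul_apply, hu, hv, map_mul, map_mul, MulAut.mul_apply]

theorem kill_cocycle (s : ℤ) (u : FreeGroup (Option I)) :
    kill (cocycle ε (fun o => FreeGroup.of o ^ s) u) =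
      cocycle (restr ε) (fun i => FreeGroup.of i ^ s) (kill u) := by
  induction u using FreeGroup.induction_on with
  | C1 => simp [cocycle_one]
  | of o =>
    rw [cocycle_of, map_zpow]
    cases o with
    | none => rw [kill_none, cocycle_one, one_zpow]
    | some i => rw [kill_some, cocycle_of]
  | inv_of o ih =>
    apply (act (restr ε) (kill (FreeGroup.of o))).injective
    rw [← kill_act, act_cocycle_inv, map_inv, map_inv, act_cocycle_inv, ih]
  | mul u v hu hv =>
    rw [cocycle_mul, map_mul, kill_act, hu, hv, map_mul, cocycle_mul]

/-- The free group on the set `FreeGroup I`, mapped to the kernel of `kill` by the conjugates of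
`Y_none ^ s`; for `s = ±1` the map is onto the kernel. -/
def conjBasis (s : ℤ) : FreeGroup (FreeGroup I) →* FreeGroup (Option I) :=
  FreeGroup.lift fun v => incl v * FreeGroup.of none ^ s * (incl v)⁻¹

theorem conjBasis_of (s : ℤ) (v : FreeGroup I) : conjBasis s (FreeGroup.of v) =
    incl v * FreeGroup.of none ^ s * (incl v)⁻¹ := FreeGroup.lift_apply_of

theorem conjBasis_map (s : ℤ) (v : FreeGroup I) (k : FreeGroup (FreeGroup I)) :
    conjBasis s (FreeGroup.map (v * ·) k) = incl v * conjBasis s k * (incl v)⁻¹ := by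
  have : (conjBasis s).comp (FreeGroup.map (v * ·)) =
      (MulAut.conj (incl v)).toMonoidHom.comp (conjBasis s) := by
    ext w
    change conjBasis s (FreeGroup.map (v * ·) (FreeGroup.of w)) =
      incl v * conjBasis s (FreeGroup.of w) * (incl v)⁻¹
    rw [FreeGroup.map.of, conjBasis_of, conjBasis_of, map_mul]
    group
  exact DFunLike.congr_fun this k

/-- The kernel of `kill` is generated by the conjugates of `Y_none` by elements of the free group on
the other generators. -/
theorem exists_eq_conjBasis_mul (s : ℤˣ) (u : FreeGroup (Option I)) :
    ∃ k, u = conjBasis s k * incl (kill u) := by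
  induction u using FreeGroup.induction_on with
  | C1 => exact ⟨1, by simp⟩
  | of o =>
    cases o with
    | none =>
      refine ⟨FreeGroup.of 1 ^ (s : ℤ), ?_⟩
      rw [kill_none, map_zpow, conjBasis_of, map_one, one_mul, inv_one, mul_one, mul_one, ← zpow_mul,
        ← Units.val_mul, Int.units_mul_self, Units.val_one, zpow_one]
    | some i => exact ⟨1, by rw [kill_some, incl, FreeGroup.map.of, map_one, one_mul]⟩
  | inv_of o ih =>
    obtain ⟨k, hk⟩ := ih
    refine ⟨FreeGroup.map ((kill (FreeGroup.of o))⁻¹ * ·) k⁻¹, ?_⟩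
    rw [conjBasis_map]
    nth_rewrite 1 [hk]
    simp only [map_inv]
    group
  | mul u v hu hv =>
    obtain ⟨k, hk⟩ := hu
    obtain ⟨l, hl⟩ := hv
    refine ⟨k * FreeGroup.map (kill u * ·) l, ?_⟩
    rw [map_mul, conjBasis_map]
    nth_rewrite 1 [hk, hl]
    simp only [map_mul]
    group

theorem exists_eq_conjBasis (s : ℤˣ) (u : FreeGroup (Option I)) (hu : kill u = 1) :
    ∃ k, u = conjBasis s k := by
  obtain ⟨k, hk⟩ := exists_eq_conjBasis_mul s u
  rw [hu, map_one, mul_one] at hk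
  exact ⟨k, hk⟩

/-- The action of a group on the free group on its elements by left translation. -/
def translation (V : Type*) [Group V] : V →* MulAut (FreeGroup V) where
  toFun v := FreeGroup.freeGroupCongr (Equiv.mulLeft v)
  map_one' := by
    apply MulEquiv.toMonoidHom_injective
    ext w
    change FreeGroup.map (1 * ·) (FreeGroup.of w) = FreeGroup.of w
    rw [FreeGroup.map.of, one_mul]
  map_mul' u v := by
    apply MulEquiv.toMonoidHom_injective
    ext w
    change FreeGroup.map (u * v * ·) (FreeGroup.of w) =
      FreeGroup.map (u * ·) (FreeGroup.map (v * ·) (FreeGroup.of w))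
    rw [FreeGroup.map.of, FreeGroup.map.of, FreeGroup.map.of, mul_assoc]

theorem translation_of {V : Type*} [Group V] (v w : V) :
    translation V v (FreeGroup.of w) = FreeGroup.of (v * w) := FreeGroup.map.of

/-- The free group as the semidirect product of the kernel of `kill`, which is free on
the conjugates of the generator `none`, and the free group on the other generators. -/
def split : FreeGroup (Option I) →*
    FreeGroup (FreeGroup I) ⋊[translation (FreeGroup I)] FreeGroup I :=
  FreeGroup.lift fun o => o.elim (SemidirectProduct.inl (FreeGroup.of 1))
    fun i => SemidirectProduct.inr (FreeGroup.of i)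

theorem split_none : split (FreeGroup.of (none : Option I)) =
    SemidirectProduct.inl (FreeGroup.of 1) := FreeGroup.lift_apply_of

theorem split_right (g : FreeGroup (Option I)) : (split g).right = kill g := by
  change (SemidirectProduct.rightHom.comp split) g = kill g
  congr 1
  ext o
  rw [MonoidHom.comp_apply, split, kill, FreeGroup.lift_apply_of, FreeGroup.lift_apply_of]
  cases o <;> rfl

theorem injective_lift_zpow {V : Type*} (s : ℤˣ) :
    Function.Injective (FreeGroup.lift fun v : V => FreeGroup.of v ^ (s : ℤ)) := by
  refine Function.LeftInverse.injective (g := FreeGroup.lift fun v : V => FreeGroup.of v ^ (s : ℤ))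
    fun x => ?_
  rw [← MonoidHom.comp_apply]
  nth_rewrite 2 [← MonoidHom.id_apply (FreeGroup V) x]
  congr 1
  ext v
  rw [MonoidHom.comp_apply, FreeGroup.lift_apply_of, map_zpow, FreeGroup.lift_apply_of, ← zpow_mul,
    ← Units.val_mul, Int.units_mul_self, Units.val_one, zpow_one]
  rfl

theorem inv_mul_inl_mul {N G : Type*} [Group N] [Group G] {φ : G →* MulAut N} (p : N ⋊[φ] G)
    (y : N) : p⁻¹ * SemidirectProduct.inl y * p =
      SemidirectProduct.inl (φ p.right⁻¹ (p.left⁻¹ * y * p.left)) := by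
  rw [map_inv φ, SemidirectProduct.inl_aut_inv]
  nth_rewrite 1 2 [← SemidirectProduct.inl_left_mul_inr_right p]
  simp only [map_mul, map_inv]
  group

/-- Conjugates of a generator `none` are independent if the conjugating elements are distinct
modulo `none`. -/
theorem injective_lift_conj_none (s : ℤˣ) (g : FreeGroup I → FreeGroup (Option I))
    (hg : Function.Injective fun v => kill (g v)) :
    Function.Injective
      (FreeGroup.lift fun v => (g v)⁻¹ * FreeGroup.of none ^ (s : ℤ) * g v) := by
  let V := FreeGroup I
  let r : V → V := fun v => (kill (g v))⁻¹
  have hr : Function.Injective r := fun v w h => hg (inv_injective h)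
  -- in the coordinates of `split`, the conjugates are conjugates of distinct basis elements `r v`
  let x : V → FreeGroup V := fun v => translation V (r v) (split (g v)).left
  let θ : FreeGroup V →* FreeGroup V :=
    FreeGroup.lift fun v => (x v)⁻¹ * FreeGroup.of (r v) ^ (s : ℤ) * x v
  have h1 : split.comp (FreeGroup.lift fun v => (g v)⁻¹ * FreeGroup.of none ^ (s : ℤ) * g v) =
      SemidirectProduct.inl.comp θ := by
    ext1 v
    rw [MonoidHom.comp_apply, MonoidHom.comp_apply, FreeGroup.lift_apply_of,
      FreeGroup.lift_apply_of, map_mul, map_mul, map_inv, map_zpow, split_none, ← map_zpow]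
    have h2 : translation V (r v) (FreeGroup.of 1) = FreeGroup.of (r v) := by
      rw [translation_of, mul_one]
    rw [inv_mul_inl_mul, split_right, ← h2]
    congr 1
    rw [map_mul, map_mul, map_inv, map_zpow]

  -- a retraction that maps the basis elements `r v` to the generators
  let ρ : FreeGroup V →* FreeGroup V := FreeGroup.map (Function.invFun r)
  have h3 : ρ.comp θ = (FreeGroup.lift fun v => (ρ (x v))⁻¹ * FreeGroup.of v * ρ (x v)).comp
      (FreeGroup.lift fun v => FreeGroup.of v ^ (s : ℤ)) := by
    ext1 v
    have h4 : ρ (FreeGroup.of (r v)) = FreeGroup.of v := by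
      change FreeGroup.map _ _ = _
      rw [FreeGroup.map.of, Function.leftInverse_invFun hr]
    rw [MonoidHom.comp_apply, MonoidHom.comp_apply, FreeGroup.lift_apply_of,
      FreeGroup.lift_apply_of, map_mul, map_mul, map_inv, map_zpow, h4, map_zpow,
      FreeGroup.lift_apply_of]
    have h5 : ∀ y z : FreeGroup V, (y⁻¹ * z * y) ^ (s : ℤ) = y⁻¹ * z ^ (s : ℤ) * y := by
      intro y z
      simpa using conj_zpow (a := y⁻¹) (b := z) (i := (s : ℤ))
    rw [h5]
  have h6 : Function.Injective (ρ ∘ θ) := by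
    change Function.Injective (ρ.comp θ)
    rw [h3]
    exact (FreeGroup.injective_lift_conj _).comp (injective_lift_zpow s)
  have h7 : Function.Injective (SemidirectProduct.inl.comp θ :
      FreeGroup V →* FreeGroup V ⋊[translation V] V) :=
    SemidirectProduct.inl_injective.comp h6.of_comp
  rw [← h1] at h7
  exact Function.Injective.of_comp (f := split) h7

end Elimination

/-- The homomorphism `u ↦ (e(u)⁻¹, e(u) * act u * e(u)⁻¹)` to the semidirect product, where `e` is
a cocycle with respect to the action `act ε`. -/
def twisted : FreeGroup I →* FreeGroup I ⋊[MonoidHom.id _] MulAut (FreeGroup I) :=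
  MonoidHom.mk' (fun u => ⟨(cocycle ε f u)⁻¹, MulAut.conj (cocycle ε f u) * act ε u⟩) fun u v => by
    ext1
    · change (cocycle ε f (u * v))⁻¹ = (cocycle ε f u)⁻¹ *
        (cocycle ε f u * act ε u (cocycle ε f v)⁻¹ * (cocycle ε f u)⁻¹)
      rw [cocycle_mul, map_inv]
      group
    · rw [SemidirectProduct.mul_right, cocycle_mul, map_mul, map_mul]
      ext x
      simp only [MulAut.mul_apply, MulAut.conj_apply, map_mul, map_inv, mul_inv_rev, mul_assoc]

/-- The cocycle with the value `Y_i ^ s` at the generator `i` takes the value `1` only at `1`. -/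
def IsFaithful (s : ℤ) : Prop :=
  ∀ u, cocycle ε (fun i => FreeGroup.of i ^ s) u = 1 → u = 1

/-- The elimination of one generator. By the hypothesis on the exponents, the generator `none` acts
trivially up to the inner automorphism in `twisted`. By faithfulness on the other generators,
an element at which the cocycle is trivial is a product of conjugates of `none`. On such products
the inverse of the cocycle is a homomorphism, which maps the conjugates to conjugates of `Y_none` by
values of the cocycle with the opposite exponent; by faithfulness of the latter these are
independent. -/
theorem IsFaithful.option {ε : Option I → Option I → ℤ} {s : ℤˣ}
    (h1 : ∀ j, ε none (some j) = -s) (h2 : ∀ i, ε (some i) none = s)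
    (hp : IsFaithful (restr ε) s) (hn : IsFaithful (restr ε) (-s)) : IsFaithful ε s := by
  intro u hu
  set f : Option I → FreeGroup (Option I) := fun o => FreeGroup.of o ^ (s : ℤ) with hf
  have hk : kill u = 1 := hp _ (by rw [← kill_cocycle, hu, map_one])
  obtain ⟨k, rfl⟩ := exists_eq_conjBasis (-s) u hk
  let g : FreeGroup I → FreeGroup (Option I) := fun v =>
    cocycle ε (fun o => FreeGroup.of o ^ (-s : ℤ)) (incl v)
  have hg : Function.Injective fun v => kill (g v) := by
    have h3 : (fun v => kill (g v)) = cocycle (restr ε) fun i => FreeGroup.of i ^ (-s : ℤ) := by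
      funext v
      change kill (cocycle _ _ _) = _
      rw [kill_cocycle, kill_incl]
    rw [h3]
    exact injective_of_eq_one _ _ hn
  have hact : ∀ v, act ε (incl v) (FreeGroup.of none) = (g v)⁻¹ * FreeGroup.of none * g v := by
    intro v
    refine act_eq_conj ε _ _ (fun o => ?_) _
    rw [conjAut_of]
    cases o with
    | none => group
    | some i => rw [h2, zpow_neg, inv_inv]
  have hnone : twisted ε f (FreeGroup.of none) =
      SemidirectProduct.inl (FreeGroup.of none ^ (-s : ℤ)) := by
    ext1
    · change (cocycle ε f _)⁻¹ = _
      rw [cocycle_of, SemidirectProduct.left_inl, zpow_neg]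
    · change MulAut.conj (cocycle ε f _) * act ε _ = 1
      rw [cocycle_of, act_of]
      apply MulEquiv.toMonoidHom_injective
      ext o
      change FreeGroup.of none ^ (s : ℤ) * conjAut ε none (FreeGroup.of o) *
        (FreeGroup.of none ^ (s : ℤ))⁻¹ = FreeGroup.of o
      rw [conjAut_of]
      cases o with
      | none => group
      | some j => rw [h1]; group
  have hcomp : (twisted ε f).comp (conjBasis (-s : ℤ)) = SemidirectProduct.inl.comp
      (FreeGroup.lift fun v => (g v)⁻¹ * FreeGroup.of none ^ ((1 : ℤˣ) : ℤ) * g v) := by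
    ext1 v
    rw [MonoidHom.comp_apply, MonoidHom.comp_apply, FreeGroup.lift_apply_of, conjBasis_of,
      Units.val_one, zpow_one, ← hact, map_mul, map_mul, map_inv, map_zpow, hnone, ← map_zpow,
      ← zpow_mul, neg_mul_neg, ← Units.val_mul, Int.units_mul_self, Units.val_one, zpow_one]
    rw [mul_inv_eq_iff_eq_mul]
    ext1
    · change (cocycle ε f (incl v))⁻¹ *
        (MulAut.conj (cocycle ε f (incl v)) * act ε (incl v)) (FreeGroup.of none) =
        act ε (incl v) (FreeGroup.of none) * (cocycle ε f (incl v))⁻¹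
      rw [MulAut.mul_apply, MulAut.conj_apply]
      group
    · simp
  have h4 := congrArg SemidirectProduct.left (DFunLike.congr_fun hcomp k)
  change (cocycle ε f (conjBasis (-s : ℤ) k))⁻¹ = FreeGroup.lift _ k at h4
  rw [Units.val_neg] at hu ⊢
  rw [hu, inv_one] at h4
  rw [(injective_iff_map_eq_one _).1 (injective_lift_conj_none 1 g hg) k h4.symm, map_one]

/-- Transport of faithfulness along a bijection of the indices. -/
theorem IsFaithful.of_equiv {J : Type*} (e : I ≃ J) {ε : I → I → ℤ} {δ : J → J → ℤ} {s : ℤ}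
    (h : ∀ i j, ε i j = δ (e i) (e j)) (hδ : IsFaithful δ s) : IsFaithful ε s := by
  have hact : ∀ u x, FreeGroup.map e (act ε u x) =
      act δ (FreeGroup.map e u) (FreeGroup.map e x) := by
    intro u
    induction u using FreeGroup.induction_on with
    | C1 => simp
    | of i =>
      intro x
      rw [FreeGroup.map.of, act_of, act_of]
      have : (FreeGroup.map e).comp (conjAut ε i).toMonoidHom =
          (conjAut δ (e i)).toMonoidHom.comp (FreeGroup.map e) := by
        ext1 j
        change FreeGroup.map e (conjAut ε i (FreeGroup.of j)) =
          conjAut δ (e i) (FreeGroup.map e (FreeGroup.of j))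
        rw [conjAut_of, FreeGroup.map.of, conjAut_of, map_mul, map_mul, map_inv, map_zpow,
          FreeGroup.map.of, FreeGroup.map.of, h]
      exact DFunLike.congr_fun this x
    | inv_of i ih =>
      intro x
      apply (act δ (FreeGroup.map e (FreeGroup.of i))).injective
      rw [← ih, act_act_inv, map_inv, act_act_inv]
    | mul u v hu hv =>
      intro x
      rw [map_mul, MulAut.mul_apply, hu, hv, map_mul, map_mul, MulAut.mul_apply]
  have hcoc : ∀ u, FreeGroup.map e (cocycle ε (fun i => FreeGroup.of i ^ s) u) =
      cocycle δ (fun i => FreeGroup.of i ^ s) (FreeGroup.map e u) := by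
    intro u
    induction u using FreeGroup.induction_on with
    | C1 => simp [cocycle_one]
    | of i => rw [FreeGroup.map.of, cocycle_of, cocycle_of, map_zpow, FreeGroup.map.of]
    | inv_of i ih =>
      apply (act δ (FreeGroup.map e (FreeGroup.of i))).injective
      rw [← hact, act_cocycle_inv, map_inv, map_inv, act_cocycle_inv, ih]
    | mul u v hu hv => rw [cocycle_mul, map_mul, hact, hu, hv, map_mul, cocycle_mul]
  intro u hu
  have h1 := hδ (FreeGroup.map e u) (by rw [← hcoc, hu, map_one])
  exact (FreeGroup.freeGroupCongr e).injective (h1.trans (map_one _).symm)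

/-- The exponents `1` for `j < i` and `-1` for `i < j`. -/
def orderSign (n : ℕ) (i j : Fin n) : ℤ := if j < i then 1 else if i < j then -1 else 0

/-- The cocycle is faithful by induction on the number of generators. Both signs of `s` are needed
at once, since the elimination of a generator changes the sign. -/
theorem isFaithful_orderSign (n : ℕ) (s : ℤˣ) : IsFaithful (orderSign n) s := by
  induction n generalizing s with
  | zero => exact fun u _ => Subsingleton.elim _ _
  | succ n ih =>
    -- the first generator is eliminated if `s = 1`, and the last one if `s = -1`
    obtain rfl | rfl := Int.units_eq_one_or s
    · refine IsFaithful.of_equiv (δ := fun o p => orderSign (n + 1) ((finSuccEquiv n).symm o)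
        ((finSuccEquiv n).symm p)) (finSuccEquiv n) (fun i j => by simp)
        (IsFaithful.option (fun j => ?_) (fun i => ?_) ?_ ?_)
      · simp [orderSign]
      · simp [orderSign]
      · convert ih 1 using 1
        funext i j
        simp [restr, orderSign]
      · convert ih (-1) using 1
        · funext i j
          simp [restr, orderSign]
        · rfl
    · refine IsFaithful.of_equiv (δ := fun o p => orderSign (n + 1) (finSuccEquivLast.symm o)
        (finSuccEquivLast.symm p)) finSuccEquivLast (fun i j => by simp)
        (IsFaithful.option (fun j => ?_) (fun i => ?_) ?_ ?_)
      · simp [orderSign, Fin.castSucc_lt_last, (Fin.castSucc_lt_last _).not_gt]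
      · simp [orderSign, Fin.castSucc_lt_last, (Fin.castSucc_lt_last _).not_gt]
      · convert ih (-1) using 1
        funext i j
        simp [restr, orderSign]
      · convert ih 1 using 1
        · funext i j
          simp [restr, orderSign]
        · rfl

end TwistedFree

/-! ### The Hurwitz action of braids on cables -/

/-- Words in pairs `(w, s)` of elements of a group. The pair `(w, s)` stands for a strand which is
labelled by the conjugate `w * s * w⁻¹` of `s`, and a word for a cable of parallel strands. -/
def Cable (G : Type*) : Type _ := FreeMonoid (G × G)

namespace Cable

variable {G : Type*}

instance : Monoid (Cable G) := inferInstanceAs (Monoid (FreeMonoid (G × G)))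

/-- The cable that consists of one strand. -/
def single (w s : G) : Cable G := FreeMonoid.of (w, s)

/-- The number of strands. -/
def length (l : Cable G) : ℕ := FreeMonoid.length (α := G × G) l

theorem mul_inj_of_length {l₁ l₂ m₁ m₂ : Cable G} (h : length l₁ = length m₁)
    (h' : l₁ * l₂ = m₁ * m₂) : l₁ = m₁ ∧ l₂ = m₂ :=
  List.append_inj h' h

theorem single_injective {w s w' s' : G} (h : single w s = single w' s') : w = w' :=
  congrArg Prod.fst (FreeMonoid.of_injective h)

/-- The sequence of cables in which the cables at the positions `k` and `k + 1` are joined. -/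
def join (k : ℕ) (t : ℕ → Cable G) (j : ℕ) : Cable G :=
  if j < k then t j else if j = k then t k * t (k + 1) else t (j + 1)

theorem join_lt {k j : ℕ} (t : ℕ → Cable G) (h : j < k) : join k t j = t j := if_pos h
theorem join_self {k j : ℕ} (t : ℕ → Cable G) (h : j = k) : join k t j = t k * t (k + 1) := by
  rw [join, if_neg (by omega), if_pos h]
theorem join_gt {k j : ℕ} (t : ℕ → Cable G) (h : k < j) : join k t j = t (j + 1) := by
  rw [join, if_neg (by omega), if_neg (by omega)]

variable [Group G]

/-- The action of the group by left multiplication on the first components. -/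
instance : MulDistribMulAction G (Cable G) where
  smul g l := FreeMonoid.map (fun x => (g * x.1, x.2)) l
  one_smul l := by
    change FreeMonoid.map (fun x => (1 * x.1, x.2)) l = l
    simp only [one_mul]
    exact DFunLike.congr_fun (FreeMonoid.map_id (α := G × G)) l
  mul_smul g h l := by
    change FreeMonoid.map _ l = FreeMonoid.map _ (FreeMonoid.map _ l)
    refine Eq.trans ?_ (FreeMonoid.map_map (α₁ := G × G) (x := l)).symm
    congr 2
    funext x
    simp [mul_assoc]
  smul_mul g := map_mul _
  smul_one g := map_one _

/-- The product of the labels of the strands. -/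
def label : Cable G →* G := FreeMonoid.lift fun x => x.1 * x.2 * x.1⁻¹

theorem smul_single (g w s : G) : g • single w s = single (g * w) s :=
  FreeMonoid.map_of (fun x : G × G => (g * x.1, x.2)) (w, s)

theorem label_single (w s : G) : label (single w s) = w * s * w⁻¹ := FreeMonoid.lift_eval_of _ _

theorem label_smul (g : G) (l : Cable G) : label (g • l) = g * label l * g⁻¹ := by
  have : (label (G := G)).comp (MulDistribMulAction.toMonoidHom (Cable G) g) =
      (MulAut.conj g).toMonoidHom.comp label := by
    refine FreeMonoid.hom_eq fun x => ?_
    change label (g • single x.1 x.2) = g * label (single x.1 x.2) * g⁻¹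
    rw [smul_single, label_single, label_single]
    group
  exact DFunLike.congr_fun this l

theorem length_smul (g : G) (l : Cable G) : length (g • l) = length l := by
  exact (congrArg List.length (FreeMonoid.toList_map _ l)).trans (List.length_map _)

/-- The Hurwitz move at the positions `i` and `i + 1`: the cable at `i` moves to `i + 1`, and
the cable at `i + 1` moves to `i` and is acted on by the label of the former. -/
def move (i : ℕ) : Equiv.Perm (ℕ → Cable G) where
  toFun t j := if j = i then label (t i) • t (i + 1) else if j = i + 1 then t i else t j
  invFun t j := if j = i then t (i + 1) else if j = i + 1 then (label (t (i + 1)))⁻¹ • t i else t j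
  left_inv t := by
    funext j
    by_cases h : j = i
    · simp [h]
    · by_cases h' : j = i + 1
      · simp [h']
      · simp [h, h']
  right_inv t := by
    funext j
    by_cases h : j = i
    · simp [h]
    · by_cases h' : j = i + 1
      · simp [h']
      · simp [h, h']

theorem move_apply (i : ℕ) (t : ℕ → Cable G) (j : ℕ) : move i t j =
    if j = i then label (t i) • t (i + 1) else if j = i + 1 then t i else t j := rfl

theorem move_comm {i j : ℕ} (h : i + 1 < j) :
    (move i : Equiv.Perm (ℕ → Cable G)) * move j = move j * move i := by
  ext1 t
  funext k
  simp only [Equiv.Perm.mul_apply, move_apply]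
  grind

theorem move_braid (i : ℕ) : (move i : Equiv.Perm (ℕ → Cable G)) * move (i + 1) * move i =
    move (i + 1) * move i * move (i + 1) := by
  have e : i ≠ i + 1 + 1 := by omega
  have e' : i + 1 + 1 ≠ i := by omega
  ext1 t
  funext k
  rcases (by omega : k = i ∨ k = i + 1 ∨ k = i + 2 ∨ (k ≠ i ∧ k ≠ i + 1 ∧ k ≠ i + 2))
    with h | h | h | ⟨h1, h2, h3⟩
  · subst h; simp [Equiv.Perm.mul_apply, move_apply, label_smul, smul_smul, e, e']
  · subst h; simp [Equiv.Perm.mul_apply, move_apply, label_smul, smul_smul, e, e']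
  · subst h; simp [Equiv.Perm.mul_apply, move_apply, label_smul, smul_smul, e, e']
  · simp [Equiv.Perm.mul_apply, move_apply, h1, h2, h3]

/-- The Hurwitz action of braids on sequences of cables. Only the positions `0, …, n` matter. -/
def hurwitz (n : ℕ) : BraidGroup n →* Equiv.Perm (ℕ → Cable G) :=
  BraidGroup.lift (fun i => move i) (fun _ _ h => move_comm h) (fun i j h => by
    rw [← h]; exact move_braid i)

theorem hurwitz_gen {n i : ℕ} (h : i < n) :
    (hurwitz n (BraidGroup.gen n i) : Equiv.Perm (ℕ → Cable G)) = move i :=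
  BraidGroup.lift_gen _ _ _ h

theorem hurwitz_inv_apply {n : ℕ} (a : BraidGroup n) (t : ℕ → Cable G) :
    hurwitz n a (hurwitz n a⁻¹ t) = t := by
  rw [map_inv]
  exact (hurwitz n a).apply_symm_apply t

theorem length_hurwitz {n : ℕ} (a : BraidGroup n) (t : ℕ → Cable G) (k : Fin (n + 1)) :
    length (hurwitz n a t k) = length (t (BraidGroup.ends a k)) := by
  induction a using BraidGroup.induct generalizing t k with
  | hg i hi =>
    rw [hurwitz_gen hi, move_apply, BraidGroup.ends_gen hi, BraidGroup.pos]
    split_ifs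
    · rw [length_smul]
    · rfl
    · rfl
  | h1 => simp [BraidGroup.ends_one]
  | hm a b ha hb => rw [map_mul, Equiv.Perm.mul_apply, ha, hb, BraidGroup.ends_mul]
  | hi a ha =>
    have := ha (hurwitz n a⁻¹ t) (BraidGroup.ends a⁻¹ k)
    rw [hurwitz_inv_apply, BraidGroup.ends_ends_inv] at this
    exact this.symm

theorem join_move_lt {i k : ℕ} (h : k < i) (t : ℕ → Cable G) :
    join k (move (i + 1) t) = move i (join k t) := by
  funext j
  simp only [join, move_apply]
  grind

theorem join_move_gt {i k : ℕ} (h : i + 1 < k) (t : ℕ → Cable G) :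
    join k (move i t) = move i (join k t) := by
  funext j
  simp only [join, move_apply]
  grind

theorem join_move_self (i : ℕ) (t : ℕ → Cable G) :
    join i (move (i + 1) (move i t)) = move i (join (i + 1) t) := by
  have e : i ≠ i + 1 + 1 := by omega
  have e' : i + 1 + 1 ≠ i := by omega
  funext j
  rcases (by omega : j < i ∨ j = i ∨ j = i + 1 ∨ i + 1 < j) with h | h | h | h
  · simp [join, move_apply, h.ne, h]; grind
  · subst h; simp [join, move_apply, smul_mul', e, e']
  · subst h; simp [join, move_apply, e, e']
  · simp only [join, move_apply]; grind

theorem join_move_succ (i : ℕ) (t : ℕ → Cable G) :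
    join (i + 1) (move i (move (i + 1) t)) = move i (join i t) := by
  have e : i ≠ i + 1 + 1 := by omega
  have e' : i + 1 + 1 ≠ i := by omega
  funext j
  rcases (by omega : j < i ∨ j = i ∨ j = i + 1 ∨ i + 1 < j) with h | h | h | h
  · simp only [join, move_apply]; grind
  · subst h; simp [join, move_apply, smul_smul, e, e']
  · subst h; simp [join, move_apply, e, e']
  · simp only [join, move_apply]; grind

/-- Doubling of strands is compatible with the Hurwitz action. The braid moves the cable at its end
`ends a k` to the position `k`, since the product `a * b` acts by `b` before `a`. -/
theorem join_hurwitz_dup {n : ℕ} (a : BraidGroup n) (k : Fin (n + 1)) (t : ℕ → Cable G) :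
    join k (hurwitz (n + 1) (BraidGroup.dup a k) t) =
      hurwitz n a (join (BraidGroup.ends a k) t) := by
  induction a using BraidGroup.induct generalizing k t with
  | hg i hi =>
    rw [BraidGroup.dup_gen hi, hurwitz_gen hi, BraidGroup.ends_gen hi]
    rcases (by omega : (k : ℕ) < i ∨ (k : ℕ) = i ∨ (k : ℕ) = i + 1 ∨ i + 1 < (k : ℕ))
      with h | h | h | h
    · rw [BraidGroup.dupGen_lt h, BraidGroup.pos_lt h, hurwitz_gen (by omega), join_move_lt h]
    · rw [BraidGroup.dupGen_self h, BraidGroup.pos_self h, h, map_mul, Equiv.Perm.mul_apply,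
        hurwitz_gen (by omega), hurwitz_gen (by omega), join_move_self]
    · rw [BraidGroup.dupGen_succ h, BraidGroup.pos_succ h, h, map_mul, Equiv.Perm.mul_apply,
        hurwitz_gen (by omega), hurwitz_gen (by omega), join_move_succ]
    · rw [BraidGroup.dupGen_gt h, BraidGroup.pos_gt h, hurwitz_gen (by omega), join_move_gt h]
  | h1 => simp [BraidGroup.dup_one, BraidGroup.ends_one]
  | hm a b ha hb =>
    rw [BraidGroup.dup_mul, map_mul, Equiv.Perm.mul_apply, ha, hb, BraidGroup.ends_mul, map_mul,
      Equiv.Perm.mul_apply]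
  | hi a ha =>
    apply (hurwitz n a).injective
    rw [hurwitz_inv_apply, BraidGroup.dup_inv]
    have := ha (BraidGroup.ends a⁻¹ k)
      (hurwitz (n + 1) (BraidGroup.dup a (BraidGroup.ends a⁻¹ k))⁻¹ t)
    rw [hurwitz_inv_apply, BraidGroup.ends_ends_inv] at this
    exact this.symm

/-- The product of the labels of the first `k` cables. -/
def prefixLabel (t : ℕ → Cable G) (k : ℕ) : G :=
  match k with
  | 0 => 1
  | k + 1 => prefixLabel t k * label (t k)

theorem prefixLabel_succ (t : ℕ → Cable G) (k : ℕ) :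
    prefixLabel t (k + 1) = prefixLabel t k * label (t k) := rfl

theorem prefixLabel_join_le {k j : ℕ} (t : ℕ → Cable G) (h : j ≤ k) :
    prefixLabel (join k t) j = prefixLabel t j := by
  induction j with
  | zero => rfl
  | succ j ih => rw [prefixLabel_succ, prefixLabel_succ, ih (by omega), join_lt t (by omega)]

theorem prefixLabel_join_gt {k j : ℕ} (t : ℕ → Cable G) (h : k < j) :
    prefixLabel (join k t) j = prefixLabel t (j + 1) := by
  induction j with
  | zero => omega
  | succ j ih =>
    rcases (by omega : j = k ∨ k < j) with rfl | h
    · rw [prefixLabel_succ, prefixLabel_join_le t le_rfl, join_self t rfl, map_mul,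
        prefixLabel_succ, prefixLabel_succ, mul_assoc]
    · rw [prefixLabel_succ, ih h, join_gt t h, prefixLabel_succ t (j + 1)]

/-- The braid `a` acts on sequences of cables with total label `1` like a full twist of two cables,
of which the first one consists of the strands `0, …, k`. -/
def IsTwist (G : Type*) [Group G] {n : ℕ} (k : ℕ) (a : BraidGroup n) : Prop :=
  ∀ t : ℕ → Cable G, prefixLabel t (n + 1) = 1 → ∀ j, hurwitz n a t j =
    if j ≤ k then (prefixLabel t (k + 1))⁻¹ • t j
    else if j ≤ n then prefixLabel t (k + 1) • t j else t j

theorem isTwist_fullTwist : IsTwist G 0 (PureBraidGroup.fullTwist : BraidGroup 1) := by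
  intro t ht j
  change hurwitz 1 (BraidGroup.gen 1 0 ^ 2) t j = _
  rw [pow_two, map_mul, Equiv.Perm.mul_apply, hurwitz_gen one_pos]
  have h1 : label (t 0) * label (t 1) = 1 := by
    simpa [prefixLabel] using ht
  have h2 := eq_inv_of_mul_eq_one_right h1
  rcases (by omega : j = 0 ∨ j = 1 ∨ 1 < j) with rfl | rfl | h
  · simp [move_apply, prefixLabel, label_smul, smul_smul, h2]
  · simp [move_apply, prefixLabel]
  · simp only [move_apply]; grind

/-- Doubling of a strand enlarges one of the two cables of a twist. -/
theorem IsTwist.dup {n k : ℕ} {a : BraidGroup n} (ha : a ∈ PureBraidGroup n) (h : IsTwist G k a)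
    (m : Fin (n + 1)) :
    IsTwist G (if (m : ℕ) ≤ k then k + 1 else k) (BraidGroup.dup a m) := by
  intro t ht j
  have hpure := (PureBraidGroup.mem_iff _).1 (PureBraidGroup.dup_mem ha m)
  have hjoin := join_hurwitz_dup a m t
  rw [(PureBraidGroup.mem_iff a).1 ha m] at hjoin
  have hm := m.2
  have hact := h (join m t) (by rw [prefixLabel_join_gt t hm, ht])
  rw [← hjoin] at hact
  set t' := hurwitz (n + 1) (BraidGroup.dup a m) t with ht'
  have hU : prefixLabel (join m t) (k + 1) =
      prefixLabel t ((if (m : ℕ) ≤ k then k + 1 else k) + 1) := by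
    split_ifs with hmk
    · rw [prefixLabel_join_gt t (by omega)]
    · rw [prefixLabel_join_le t (by omega)]
  rw [hU] at hact
  generalize prefixLabel t ((if (m : ℕ) ≤ k then k + 1 else k) + 1) = U at hact ⊢
  -- the cable at position `m` of the joined sequence is split by counting strands
  have hsplit : t' m = (if (m : ℕ) ≤ k then U⁻¹ else U) • t m ∧
      t' (m + 1) = (if (m : ℕ) ≤ k then U⁻¹ else U) • t (m + 1) := by
    refine mul_inj_of_length ?_ ?_
    · rw [length_smul, ht']
      have := length_hurwitz (BraidGroup.dup a m) t m.castSucc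
      rwa [hpure] at this
    · rw [← smul_mul', ← join_self t' rfl, hact, ← join_self t rfl]
      split_ifs
      · rfl
      · rfl
      · omega
  rcases (by omega : j < m ∨ j = m ∨ j = m + 1 ∨ (m : ℕ) + 1 < j) with hj | rfl | rfl | hj
  · have := hact j
    rw [join_lt t' hj, join_lt t hj] at this
    rw [this]
    grind
  · rw [hsplit.1]
    grind
  · rw [hsplit.2]
    grind
  · obtain ⟨j, rfl⟩ : ∃ i, j = i + 1 := ⟨j - 1, by omega⟩
    have := hact j
    rw [join_gt t' (by omega), join_gt t (by omega)] at this
    rw [this]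
    grind

end Cable

/-! ### Homomorphisms to the braid group given by twists -/

namespace TwistedFree

variable {n : ℕ}

/-- The product of the labels of the first `j` strands. It is the generator `Y_{j-1}` for
`1 ≤ j ≤ n`, and `1` for `j = 0` and for `j = n + 1`, so that the total label is `1`. -/
def boundary (n j : ℕ) : FreeGroup (Fin n) :=
  if h : 0 < j ∧ j ≤ n then FreeGroup.of ⟨j - 1, by omega⟩ else 1

/-- The label of the strand `j`. -/
def strandLabel (n j : ℕ) : FreeGroup (Fin n) := (boundary n j)⁻¹ * boundary n (j + 1)

/-- The values at the generators of the cocycle that describes the conjugations of the strand `j`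
by the twists: the strand belongs to the first cable of the twist `i` if `j ≤ i`. -/
def strandValue (n j : ℕ) (i : Fin n) : FreeGroup (Fin n) :=
  if j ≤ i then (FreeGroup.of i)⁻¹ else FreeGroup.of i

theorem boundary_succ (i : Fin n) : boundary n (i + 1) = FreeGroup.of i := by
  rw [boundary, dif_pos ⟨by omega, i.2⟩]
  rfl

theorem conjAut_boundary_le (i : Fin n) (j : ℕ) (h : j ≤ i + 1) :
    conjAut (orderSign n) i (boundary n j) =
      FreeGroup.of i * boundary n j * (FreeGroup.of i)⁻¹ := by
  unfold boundary
  split_ifs with hj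
  · rw [conjAut_of, orderSign]
    rcases (by omega : j = i + 1 ∨ j - 1 < (i : ℕ)) with rfl | h'
    · simp
    · rw [if_pos (Fin.lt_def.2 h'), zpow_one]
  · simp

theorem conjAut_boundary_ge (i : Fin n) (j : ℕ) (h : i + 1 ≤ j) :
    conjAut (orderSign n) i (boundary n j) =
      (FreeGroup.of i)⁻¹ * boundary n j * FreeGroup.of i := by
  unfold boundary
  split_ifs with hj
  · rw [conjAut_of, orderSign]
    rcases (by omega : j = i + 1 ∨ (i : ℕ) < j - 1) with rfl | h'
    · simp
    · rw [if_neg (not_lt.2 (le_of_lt (Fin.lt_def.2 h'))), if_pos (Fin.lt_def.2 h')]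
      simp
  · simp

theorem conjAut_strandLabel (i : Fin n) (j : ℕ) : conjAut (orderSign n) i (strandLabel n j) =
    (strandValue n j i)⁻¹ * strandLabel n j * strandValue n j i := by
  rw [strandLabel, map_mul, map_inv, strandValue]
  split_ifs with h
  · rw [conjAut_boundary_le i j (by omega), conjAut_boundary_le i (j + 1) (by omega)]
    group
  · rw [conjAut_boundary_ge i j (by omega), conjAut_boundary_ge i (j + 1) (by omega)]
    group

/-- The sequence of strands which corresponds to the element `u` of the free group: the strand `j`
carries the label `strandLabel n j`, conjugated by the inverse of the value at `u` of its cocycle.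
The positions after `n` are empty. -/
def strands (u : FreeGroup (Fin n)) (j : ℕ) : Cable (FreeGroup (Fin n)) :=
  if j ≤ n then
    Cable.single (cocycle (orderSign n) (strandValue n j) u)⁻¹ (strandLabel n j)
  else 1

theorem label_strands (u : FreeGroup (Fin n)) {j : ℕ} (h : j ≤ n) :
    Cable.label (strands u j) = act (orderSign n) u (strandLabel n j) := by
  rw [strands, if_pos h, Cable.label_single, act_eq_conj _ _ _ fun i => conjAut_strandLabel i j,
    inv_inv]

theorem prefixLabel_strands (u : FreeGroup (Fin n)) {j : ℕ} (h : j ≤ n + 1) :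
    Cable.prefixLabel (strands u) j = act (orderSign n) u (boundary n j) := by
  induction j with
  | zero =>
    rw [boundary, dif_neg (by omega), map_one]
    rfl
  | succ j ih =>
    rw [Cable.prefixLabel_succ, ih (by omega), label_strands u (by omega), ← map_mul, strandLabel,
      mul_inv_cancel_left]

/-- A twist moves the sequence of strands backwards along a generator of the free group. -/
theorem hurwitz_strands {i : Fin n} {a : BraidGroup n}
    (ha : Cable.IsTwist (FreeGroup (Fin n)) i a) (u : FreeGroup (Fin n)) :
    Cable.hurwitz n a (strands (u * FreeGroup.of i)) = strands u := by
  funext j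
  have h1 : Cable.prefixLabel (strands (u * FreeGroup.of i)) (i + 1) =
      act (orderSign n) u (FreeGroup.of i) := by
    rw [prefixLabel_strands _ (by omega), boundary_succ, map_mul, MulAut.mul_apply, act_of,
      conjAut_of]
    simp [orderSign]
  rw [ha _ (by rw [prefixLabel_strands _ le_rfl, boundary, dif_neg (by omega), map_one]), h1]
  by_cases hj : j ≤ n
  · rw [strands, strands, if_pos hj, if_pos hj, if_pos hj, cocycle_mul, cocycle_of, strandValue]
    split_ifs with h
    · rw [← map_inv, Cable.smul_single, mul_inv_rev, ← map_inv, inv_inv, ← mul_assoc, ← map_mul]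
      simp
    · rw [Cable.smul_single, mul_inv_rev, mul_inv_cancel_left]
  · rw [strands, strands, if_neg hj, if_neg hj, if_neg hj, if_neg (by omega)]

/-- A homomorphism which maps the generator `i` to a braid that acts like the full twist of
the cables `0, …, i` and `i + 1, …, n` is injective. -/
theorem injective_of_isTwist (θ : FreeGroup (Fin n) →* BraidGroup n)
    (hθ : ∀ i : Fin n, Cable.IsTwist (FreeGroup (Fin n)) i (θ (FreeGroup.of i))) :
    Function.Injective θ := by
  have key : ∀ v u : FreeGroup (Fin n), Cable.hurwitz n (θ v) (strands (u * v)) = strands u := by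
    intro v
    induction v using FreeGroup.induction_on with
    | C1 => simp
    | of i => exact hurwitz_strands (hθ i)
    | inv_of i ih =>
      intro u
      apply (Cable.hurwitz n (θ (FreeGroup.of i))).injective
      rw [map_inv, Cable.hurwitz_inv_apply, ← ih (u * (FreeGroup.of i)⁻¹), inv_mul_cancel_right]
    | mul v w hv hw =>
      intro u
      rw [map_mul, map_mul, Equiv.Perm.mul_apply, ← mul_assoc, hw, hv]
  rw [injective_iff_map_eq_one]
  intro v hv
  -- the cocycle of the last strand has the values `Y_i` at the generators
  have h1 := congrFun (key v 1) n
  rw [hv, map_one, one_mul, Equiv.Perm.one_apply, strands, strands, if_pos le_rfl,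
    if_pos le_rfl] at h1
  have h2 := inv_injective (Cable.single_injective h1)
  rw [cocycle_one] at h2
  refine isFaithful_orderSign n 1 v ?_
  rw [← h2]
  congr 1
  funext i
  rw [strandValue, if_neg (by omega), Units.val_one, zpow_one]

end TwistedFree

/-! ### Simplices of the circle -/

namespace SSet.S1

theorem map_z {n : SimplexCategory} (f : n ⟶ ⦋1⦌) :
    SSet.S1.map f.op z = proj.app (op n) (stdSimplex.objEquiv.symm f) := by
  have : proj = yonedaEquiv.symm z := (Equiv.symm_apply_apply _ _).symm
  rw [this]
  rfl

/-- The `1`-simplex `z` generates the circle. -/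
theorem exists_eq_map_z {n : SimplexCategoryᵒᵖ} (y : SSet.S1.obj n) :
    ∃ f : n.unop ⟶ ⦋1⦌, y = SSet.S1.map f.op z := by
  have hepi : Epi proj :=
    inferInstanceAs (Epi (Limits.coequalizer.π (stdSimplex.δ 0 : Δ[0] ⟶ Δ[1]) (stdSimplex.δ 1)))
  have hsurj := (epi_iff_surjective (proj.app n)).1 inferInstance
  obtain ⟨α, rfl⟩ := hsurj y
  exact ⟨stdSimplex.objEquiv α, ((map_z _).trans (by rw [Equiv.symm_apply_apply])).symm⟩

theorem δ_one_z : SSet.S1.δ 1 z = pt := by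
  have h : (stdSimplex.δ 0 : Δ[0] ⟶ Δ[1]) ≫ proj = stdSimplex.δ 1 ≫ proj :=
    Limits.coequalizer.condition _ _
  have key : ∀ i : Fin 2, yonedaEquiv ((stdSimplex.δ i : Δ[0] ⟶ Δ[1]) ≫ proj) =
      SSet.S1.δ i z := by
    intro i
    rw [yonedaEquiv_comp]
    exact (map_z (SimplexCategory.δ i)).symm
  rw [pt, ← key, ← key, h]

theorem map_toMk₁_zero (n : ℕ) :
    SSet.S1.map (SimplexCategory.toMk₁ (0 : Fin (n + 2))).op z =
      SSet.S1.basepoint pt (op ⦋n⦌) := by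
  have : SimplexCategory.toMk₁ (0 : Fin (n + 2)) =
      SimplexCategory.const ⦋n⦌ ⦋0⦌ 0 ≫ SimplexCategory.δ 0 := by
    ext j
    rfl
  rw [this, op_comp, Functor.map_comp]
  rfl

theorem map_toMk₁_last (n : ℕ) :
    SSet.S1.map (SimplexCategory.toMk₁ (Fin.last (n + 1))).op z =
      SSet.S1.basepoint pt (op ⦋n⦌) := by
  have : SimplexCategory.toMk₁ (Fin.last (n + 1)) =
      SimplexCategory.const ⦋n⦌ ⦋0⦌ 0 ≫ SimplexCategory.δ 1 := by
    ext j
    change (SimplexCategory.toMk₁ (Fin.last (n + 1)) j : ℕ) = 0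
    rw [SimplexCategory.toMk₁_of_castSucc_lt _ _ (Fin.castSucc_lt_last j)]
    rfl
  rw [this, op_comp, Functor.map_comp, basepoint, ← δ_one_z]
  rfl

theorem eq_basepoint_or_zSimplex {n : ℕ} (y : SSet.S1 _⦋n⦌) :
    y = SSet.S1.basepoint pt (op ⦋n⦌) ∨ ∃ i, y = zSimplex n i := by
  obtain ⟨f, rfl⟩ := exists_eq_map_z y
  obtain ⟨i, rfl⟩ := SimplexCategory.toMk₁_surjective f
  induction i using Fin.cases with
  | zero => exact Or.inl (map_toMk₁_zero n)
  | succ i =>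
    induction i using Fin.lastCases with
    | last => exact Or.inl (map_toMk₁_last n)
    | cast i => exact Or.inr ⟨i, rfl⟩

theorem zSimplex_one : zSimplex 1 0 = z := by
  have : SimplexCategory.toMk₁ (n := 1) (Fin.castSucc (Fin.succ 0)) = 𝟙 ⦋1⦌ := by
    ext j
    fin_cases j <;> rfl
  rw [zSimplex, this, op_id, CategoryTheory.Functor.map_id]
  rfl

theorem σ_zSimplex_of_le {n : ℕ} (i : Fin n) (m : Fin (n + 1)) (h : (m : ℕ) ≤ i) :
    SSet.S1.σ m (zSimplex n i) = zSimplex (n + 1) i.succ := by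
  rw [zSimplex, zSimplex, SimplicialObject.σ, ← comp_apply, ← Functor.map_comp, ← op_comp,
    SimplexCategory.σ_comp_toMk₁_of_lt]
  · rfl
  · rw [Fin.lt_def]
    simp
    omega

theorem σ_zSimplex_of_gt {n : ℕ} (i : Fin n) (m : Fin (n + 1)) (h : (i : ℕ) < m) :
    SSet.S1.σ m (zSimplex n i) = zSimplex (n + 1) i.castSucc := by
  rw [zSimplex, zSimplex, SimplicialObject.σ, ← comp_apply, ← Functor.map_comp, ← op_comp,
    SimplexCategory.σ_comp_toMk₁_of_le]
  · rfl
  · rw [Fin.le_def]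
    simp
    omega

end SSet.S1

/-! ### Homomorphisms out of Milnor's construction -/

namespace MilnorF

variable {X : SSet.{u}} {x : X _⦋0⦌}

theorem map_of {n m : SimplexCategoryᵒᵖ} (f : n ⟶ m) (y : X.obj n) :
    (MilnorF X x).map f (of y) = of (X.map f y) := by
  change PresentedGroup.mk _ (FreeGroup.map (X.map f) (FreeGroup.of y)) = _
  rw [FreeGroup.map.of]
  rfl

theorem of_basepoint (n : SimplexCategoryᵒᵖ) :
    (of (X.basepoint x n) : (MilnorF X x).obj n) = 1 :=
  PresentedGroup.one_of_mem (rels := {FreeGroup.of (X.basepoint x n)}) rfl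

theorem hom_obj_ext {n : SimplexCategoryᵒᵖ} {G : Type*} [Group G] {f g : (MilnorF X x).obj n →* G}
    (h : ∀ y : X.obj n, f (of y) = g (of y)) : f = g :=
  PresentedGroup.ext h

theorem hom_ext {K : SimplicialObject GrpCat.{u}} {Φ Ψ : MilnorF X x ⟶ K}
    (h : ∀ n (y : X.obj n), Φ.app n (of y) = Ψ.app n (of y)) : Φ = Ψ := by
  refine NatTrans.ext (funext fun n => GrpCat.hom_ext (hom_obj_ext (h n)))

theorem lift_basepoint {K : SimplicialObject GrpCat.{u}} (g : X ⟶ K ⋙ forget GrpCat)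
    (hg : (g.app (op ⦋0⦌) x : K _⦋0⦌) = 1) (n : SimplexCategoryᵒᵖ) :
    ∀ r ∈ ({FreeGroup.of (X.basepoint x n)} : Set (FreeGroup (X.obj n))),
      FreeGroup.lift (fun y => (g.app n y : K.obj n)) r = 1 := by
  rintro _ rfl
  rw [FreeGroup.lift_apply_of]
  have := NatTrans.naturality_apply g (n.unop.const ⦋0⦌ 0).op x
  refine this.trans ?_
  exact (congrArg (K.map (n.unop.const ⦋0⦌ 0).op) hg).trans (map_one _)

/-- The universal property of Milnor's construction: a map of simplicial sets to a simplicial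
group which maps the base point to `1` extends to a homomorphism of simplicial groups. -/
def desc {K : SimplicialObject GrpCat.{u}} (g : X ⟶ K ⋙ forget GrpCat)
    (hg : (g.app (op ⦋0⦌) x : K _⦋0⦌) = 1) : MilnorF X x ⟶ K where
  app n := GrpCat.ofHom (PresentedGroup.toGroup (lift_basepoint g hg n))
  naturality n m f := by
    refine GrpCat.hom_ext (hom_obj_ext fun y => ?_)
    have h1 : ∀ k (y : X.obj k), PresentedGroup.toGroup (lift_basepoint g hg k) (of y) =
      (g.app k y : K.obj k) := fun k y => PresentedGroup.toGroup.of _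
    change PresentedGroup.toGroup (lift_basepoint g hg m) ((MilnorF X x).map f (of y)) =
      K.map f (PresentedGroup.toGroup (lift_basepoint g hg n) (of y))
    rw [map_of, h1, h1]
    exact NatTrans.naturality_apply g f y

theorem desc_of {K : SimplicialObject GrpCat.{u}} (g : X ⟶ K ⋙ forget GrpCat)
    (hg : (g.app (op ⦋0⦌) x : K _⦋0⦌) = 1)
    {n : SimplexCategoryᵒᵖ} (y : X.obj n) :
    (desc (x := x) g hg).app n (of y) = (g.app n y : K.obj n) :=
  PresentedGroup.toGroup.of (lift_basepoint g hg n)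

end MilnorF

/-! ### The homomorphism to the simplicial group of pure braids -/

namespace FS1

/-- The braid group on one strand is trivial. -/
instance : Subsingleton (AP _⦋0⦌) := by
  have h : ∀ a : BraidGroup 0, a = 1 := fun a => by
    induction a using BraidGroup.induct with
    | hg i hi => omega
    | h1 => rfl
    | hm a b ha hb => rw [ha, hb, one_mul]
    | hi a ha => rw [ha, inv_one]
  exact ⟨fun a b => Subtype.ext ((h (Subtype.val a)).trans (h (Subtype.val b)).symm)⟩

/-- The map from the circle with the value `A_{1,2}` at its nondegenerate `1`-simplex. -/
noncomputable def circleMap : SSet.S1 ⟶ AP ⋙ forget GrpCat :=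
  Limits.coequalizer.desc (SSet.yonedaEquiv.symm (AP.A₁₂ : (AP ⋙ forget GrpCat).obj (op ⦋1⦌)))
    (SSet.yonedaEquiv.injective (Subsingleton.elim (α := AP _⦋0⦌) _ _))

theorem circleMap_z : (circleMap.app (op ⦋1⦌) SSet.S1.z : AP _⦋1⦌) = AP.A₁₂ := by
  have h : SSet.S1.proj ≫ circleMap =
      SSet.yonedaEquiv.symm (AP.A₁₂ : (AP ⋙ forget GrpCat).obj (op ⦋1⦌)) :=
    Limits.coequalizer.π_desc _ _
  have h1 := SSet.yonedaEquiv_comp SSet.S1.proj circleMap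
  rw [h, Equiv.apply_symm_apply] at h1
  exact h1.symm

/-- The homomorphism with the value `A_{1,2}` at the nondegenerate `1`-simplex of the circle. -/
noncomputable def toAP : FS1 ⟶ AP :=
  MilnorF.desc circleMap (Subsingleton.elim (α := AP _⦋0⦌) _ _)

theorem toAP_z : toAP.app (op ⦋1⦌) (MilnorF.of SSet.S1.z) = AP.A₁₂ :=
  (MilnorF.desc_of _ _ _).trans circleMap_z

theorem naturality_of (Θ : FS1 ⟶ AP) {n m : SimplexCategoryᵒᵖ} (f : n ⟶ m) (y : SSet.S1.obj n) :
    Θ.app m (MilnorF.of (SSet.S1.map f y)) = AP.map f (Θ.app n (MilnorF.of y)) := by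
  rw [← MilnorF.map_of]
  exact NatTrans.naturality_apply Θ f _

theorem hom_unique {Θ Θ' : FS1 ⟶ AP} (h : Θ.app (op ⦋1⦌) (MilnorF.of SSet.S1.z) = AP.A₁₂)
    (h' : Θ'.app (op ⦋1⦌) (MilnorF.of SSet.S1.z) = AP.A₁₂) : Θ = Θ' := by
  refine MilnorF.hom_ext fun n y => ?_
  obtain ⟨f, rfl⟩ := SSet.S1.exists_eq_map_z y
  rw [naturality_of, naturality_of, h, h']

theorem app_of_σ (Θ : FS1 ⟶ AP) {n : ℕ} (m : Fin (n + 1)) (y : SSet.S1 _⦋n⦌) :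
    Θ.app (op ⦋n + 1⦌) (MilnorF.of (SSet.S1.σ m y)) =
      PureBraidGroup.dupHom m (Θ.app (op ⦋n⦌) (MilnorF.of y) : PureBraidGroup n) := by
  refine (naturality_of Θ (SimplexCategory.σ m).op y).trans ?_
  exact ConcreteCategory.congr_hom (AP.σ_eq m) _

/-- The homomorphism maps `z_{i+1}` to the full twist of the cables `0, …, i` and `i + 1, …, n`. -/
theorem isTwist_app (G : Type*) [Group G] {Θ : FS1 ⟶ AP}
    (h : Θ.app (op ⦋1⦌) (MilnorF.of SSet.S1.z) = AP.A₁₂) (n : ℕ) (i : Fin n) :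
    Cable.IsTwist G i
      (Θ.app (op ⦋n⦌) (MilnorF.of (SSet.S1.zSimplex n i)) : PureBraidGroup n).1 := by
  have hdup : ∀ (n : ℕ) (i : Fin n) (m : Fin (n + 1)),
      Cable.IsTwist G i
        (Θ.app (op ⦋n⦌) (MilnorF.of (SSet.S1.zSimplex n i)) : PureBraidGroup n).1 →
      Cable.IsTwist G (if (m : ℕ) ≤ i then (i : ℕ) + 1 else i) (Θ.app (op ⦋n + 1⦌)
        (MilnorF.of (SSet.S1.σ m (SSet.S1.zSimplex n i))) : PureBraidGroup (n + 1)).1 := by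
    intro n i m ih
    rw [app_of_σ]
    exact ih.dup (Subtype.prop _) m
  -- in degrees at least `2` every `z_i` is a degeneracy of some `z_j`
  induction n with
  | zero => exact i.elim0
  | succ n ih =>
    obtain _ | n := n
    · obtain rfl := Subsingleton.elim (α := Fin 1) i 0
      rw [SSet.S1.zSimplex_one, h]
      exact Cable.isTwist_fullTwist
    · induction i using Fin.cases with
      | zero =>
        have := hdup _ 0 (Fin.last (n + 1)) (ih 0)
        rwa [SSet.S1.σ_zSimplex_of_gt _ _ (by simp), if_neg (by simp)] at this
      | succ i =>
        have := hdup _ i 0 (ih i)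
        rwa [SSet.S1.σ_zSimplex_of_le _ _ (by simp), if_pos (by simp)] at this

theorem injective_app_comp_lift {Θ : FS1 ⟶ AP}
    (h : Θ.app (op ⦋1⦌) (MilnorF.of SSet.S1.z) = AP.A₁₂) (n : ℕ) :
    Function.Injective fun u => Θ.app (op ⦋n⦌)
      (FreeGroup.lift (fun i : Fin n => (MilnorF.of (SSet.S1.zSimplex n i) : FS1 _⦋n⦌)) u) := by
  have := TwistedFree.injective_of_isTwist ((PureBraidGroup n).subtype.comp
    ((Θ.app (op ⦋n⦌)).hom.comp
      (FreeGroup.lift fun i : Fin n => (MilnorF.of (SSet.S1.zSimplex n i) : FS1 _⦋n⦌)))) fun i => by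
    have := isTwist_app (FreeGroup (Fin n)) h n i
    change Cable.IsTwist _ i (Θ.app (op ⦋n⦌) (FreeGroup.lift _ (FreeGroup.of i)) :
      PureBraidGroup n).1
    rwa [FreeGroup.lift_apply_of]
  exact Function.Injective.of_comp (f := Subtype.val) this

theorem surjective_lift (n : ℕ) : Function.Surjective
    (FreeGroup.lift (fun i : Fin n => (MilnorF.of (SSet.S1.zSimplex n i) : FS1 _⦋n⦌))) := by
  set φ := FreeGroup.lift fun i : Fin n => (MilnorF.of (SSet.S1.zSimplex n i) : FS1 _⦋n⦌) with hφ
  intro w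
  refine PresentedGroup.generated_by _ φ.range (fun y => ?_) w
  change (MilnorF.of y : FS1 _⦋n⦌) ∈ φ.range
  obtain rfl | ⟨i, rfl⟩ := SSet.S1.eq_basepoint_or_zSimplex y
  · rw [MilnorF.of_basepoint]
    exact one_mem _
  · exact ⟨FreeGroup.of i, FreeGroup.lift_apply_of⟩

end FS1

theorem mainTheorem1 :
    -- `F[S¹]_n` is the free group `F(z_1, …, z_n)`
    (∀ n : ℕ, Function.Bijective
      (FreeGroup.lift (fun i : Fin n => (MilnorF.of (SSet.S1.zSimplex n i) : FS1 _⦋n⦌)))) ∧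
    -- there is exactly one homomorphism `Θ` with `Θ z = A_{1,2}`
    (∃! Θ : FS1 ⟶ AP, Θ.app (op ⦋1⦌) (MilnorF.of SSet.S1.z) = AP.A₁₂) ∧
    -- and it is injective in every degree
    (∀ Θ : FS1 ⟶ AP, Θ.app (op ⦋1⦌) (MilnorF.of SSet.S1.z) = AP.A₁₂ →
      ∀ n : ℕ, Function.Injective (Θ.app (op ⦋n⦌))) := by
  have hinj : ∀ n : ℕ, Function.Injective
      (FreeGroup.lift (fun i : Fin n => (MilnorF.of (SSet.S1.zSimplex n i) : FS1 _⦋n⦌))) :=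
    fun n => Function.Injective.of_comp (f := FS1.toAP.app (op ⦋n⦌))
      (FS1.injective_app_comp_lift FS1.toAP_z n)
  refine ⟨fun n => ⟨hinj n, FS1.surjective_lift n⟩,
    ⟨FS1.toAP, FS1.toAP_z, fun Θ h => FS1.hom_unique h FS1.toAP_z⟩, fun Θ h n x y hxy => ?_⟩
  obtain ⟨u, rfl⟩ := FS1.surjective_lift n x
  obtain ⟨v, rfl⟩ := FS1.surjective_lift n y
  exact congrArg _ (FS1.injective_app_comp_lift h n hxy)
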